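/- Let $M\ge 2$ and $p$ be integers. A curve $f:\mathbb R\to\mathbb R^p$ is CPwL if it is continuous and piecewise affine with finitely many breakpoints on every compact interval. Let $(A_j)_{j\in\mathbb Z}$ be real $p\times p$ matrices, all but finitely many of them zero, let $B:\mathbb R\to\mathbb R^p$, and put $$(V\xi)(t)=\sum_{j\in\mathbb Z}A_j\,\xi(Mt-j),\qquad W\xi=V\xi+B .$$ Let $\Gamma:\mathbb R\to\mathbb R^p$ be an anchor profile, i.e. a CPwL curve that is constant on $(-\infty,-t_*]$ and on $[t_*,\infty)$ for some $t_*>0$, such that the mismatch $E:=W\Gamma-\Gamma$ is compactly supported and CPwL, and let $\gamma=\Gamma+\eta$ with $\eta:\mathbb R\to\mathbb R^p$ compactly supported and CPwL. Write $\Upsilon_{C,D}(\mathrm{ReLU};1,p)$ for the set of outputs of fully connected ReLU networks with input dimension $1$, output dimension $p$ and $D$ hidden layers of $C$ neurons each. (a) For every $n\ge1$, $W^n\gamma=\Gamma+\bar W^{\,n}\eta$, where $\bar W\xi:=V\xi+E$. (b) There are positive integers $C_0,C_1$, independent of $n$, such that $W^n\gamma\in\Upsilon_{C_0,\,C_1n^2}(\mathrm{ReLU};1,p)$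 for all $n\ge1$. (c) Let $L\ge1$ and $m\ge0$ be integers. If $V$ preserves the support window $[0,L]$ (that is, $\operatorname{supp}V\xi\subset[0,L]$ for every continuous curve $\xi$ with $\operatorname{supp}\xi\subset[0,L]$), if $\operatorname{supp}\eta$ and $\operatorname{supp}E$ are contained in $[0,L]$, and if each of $\Gamma,\eta,E$ has at most $m$ breakpoints, then the constants $C_0,C_1$ in (b) can be chosen depending only on $M$, $p$, $L$ and $m$. -/

import Mathlib

open Filter Topology
open scoped Matrix

noncomputable section

namespace OpenCurve

/-- Componentwise ReLU on `ℝ^k`. -/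
def relu {k : ℕ} (y : Fin k → ℝ) : Fin k → ℝ := fun i => max 0 (y i)

/-- `HiddenOutput W d k g` : the map `g : ℝ^d → ℝ^W` is the output of the `k`-th hidden layer
of a fully connected ReLU network with input dimension `d`, all of whose hidden layers consist
of `W` neurons. -/
inductive HiddenOutput (W d : ℕ) : ℕ → ((Fin d → ℝ) → (Fin W → ℝ)) → Prop
  | first (K : Matrix (Fin W) (Fin d) ℝ) (b : Fin W → ℝ) :
      HiddenOutput W d 1 (fun x => relu (K *ᵥ x + b))
  | next {k : ℕ} {g : (Fin d → ℝ) → (Fin W → ℝ)} (hg : HiddenOutput W d k g)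
      (K : Matrix (Fin W) (Fin W) ℝ) (b : Fin W → ℝ) :
      HiddenOutput W d (k + 1) (fun x => relu (K *ᵥ g x + b))

/-- The class `Υ_{W,L}(ReLU; d, N)` of outputs of fully connected ReLU networks with width `W`,
depth `L` (the number of hidden layers), input dimension `d` and output dimension `N`; the output
layer is affine. -/
def Upsilon (W L d N : ℕ) : Set ((Fin d → ℝ) → (Fin N → ℝ)) :=
  {f | ∃ g, HiddenOutput W d L g ∧
    ∃ (K : Matrix (Fin N) (Fin W) ℝ) (b : Fin N → ℝ), f = fun x => K *ᵥ g x + b}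

/-- A curve `γ : ℝ → ℝ^p`, seen as a map on `ℝ^1`, belongs to `Υ_{W,L}(ReLU; 1, p)`. -/
def IsRealizedBy {p : ℕ} (γ : ℝ → Fin p → ℝ) (W L : ℕ) : Prop :=
  (fun x : Fin 1 → ℝ => γ (x 0)) ∈ Upsilon W L 1 p

/-- The breakpoints of a curve: the points that have no neighbourhood on which the curve is
affine, i.e. on which all of its components are affine. -/
def breakpoints {p : ℕ} (f : ℝ → Fin p → ℝ) : Set ℝ :=
  {t | ¬ ∃ u v : Fin p → ℝ, ∀ᶠ s in 𝓝 t, f s = u + s • v}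

/-- Continuous piecewise linear curves: continuous, with finitely many breakpoints on every
compact interval. -/
structure IsCPwL {p : ℕ} (f : ℝ → Fin p → ℝ) : Prop where
  continuous : Continuous f
  finite_breakpoints : ∀ a b : ℝ, (breakpoints f ∩ Set.Icc a b).Finite

/-- The homogeneous `M`-ary refinement operator `(Vξ)(t) = ∑_j A_j ξ(Mt - j)`; the mask
`(A_j)_{j ∈ ℤ}` vanishes for all but finitely many `j`. -/
def refine {p : ℕ} (M : ℕ) (A : ℤ →₀ Matrix (Fin p) (Fin p) ℝ) (ξ : ℝ → Fin p → ℝ) :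
    ℝ → Fin p → ℝ :=
  fun t => ∑ j ∈ A.support, A j *ᵥ ξ ((M : ℝ) * t - (j : ℝ))

/-- The affine refinement operator `Wξ = Vξ + B`. -/
def affineRefine {p : ℕ} (M : ℕ) (A : ℤ →₀ Matrix (Fin p) (Fin p) ℝ) (B ξ : ℝ → Fin p → ℝ) :
    ℝ → Fin p → ℝ :=
  refine M A ξ + B

/-- The mismatch `E = WΓ - Γ` of a curve `Γ` with respect to `W = V + B`. -/
def mismatch {p : ℕ} (M : ℕ) (A : ℤ →₀ Matrix (Fin p) (Fin p) ℝ) (B Γ : ℝ → Fin p → ℝ) :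
    ℝ → Fin p → ℝ :=
  affineRefine M A B Γ - Γ

/-- Anchor profiles: CPwL curves that are eventually constant at both ends. -/
def IsAnchorProfile {p : ℕ} (Γ : ℝ → Fin p → ℝ) : Prop :=
  IsCPwL Γ ∧ ∃ (Γl Γr : Fin p → ℝ) (t₀ : ℝ), 0 < t₀ ∧
    (∀ t, t ≤ -t₀ → Γ t = Γl) ∧ (∀ t, t₀ ≤ t → Γ t = Γr)

/-- The refinement operator `V` preserves the support window `[0, L]`: if a (continuous) curve is
supported in `[0, L]`, then so is its image. -/
def PreservesWindow {p : ℕ} (M : ℕ) (A : ℤ →₀ Matrix (Fin p) (Fin p) ℝ) (L : ℕ) : Prop :=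
  ∀ ξ : ℝ → Fin p → ℝ, Continuous ξ → tsupport ξ ⊆ Set.Icc 0 (L : ℝ) →
    tsupport (refine M A ξ) ⊆ Set.Icc 0 (L : ℝ)

/-- The standing hypotheses on an anchored open curve `Γ + η`: `Γ` is an anchor profile whose
mismatch for `W = V + B` is a compactly supported CPwL curve, and so is the defect `η`. -/
structure IsAnchoredPair {p : ℕ} (M : ℕ) (A : ℤ →₀ Matrix (Fin p) (Fin p) ℝ)
    (B Γ η : ℝ → Fin p → ℝ) : Prop where
  anchor : IsAnchorProfile Γ
  mismatch_cpwl : IsCPwL (mismatch M A B Γ)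
  mismatch_supp : HasCompactSupport (mismatch M A B Γ)
  defect_cpwl : IsCPwL η
  defect_supp : HasCompactSupport η

end OpenCurve

end

/-!
The reduction to the compactly supported defect is the identity
`W (Γ + ξ) = Γ + (V ξ + E)`, iterated (`iterate_affineRefine_add`). It remains to realize
`w n = (ξ ↦ V ξ + E)^[n] η` by a network of width independent of `n`; the depth obtained here is
even linear in `n`.

All iterates live in one window `[-N, N]`. If `M x = d + x'` with `0 ≤ x' < 1` and an integer digit
`d`, the values of `V ξ` at the integer translates of `x` are a matrix, depending only on `d`, times
the values of `ξ` at the integer translates of `x'` (`affineRefine_window`). So the values of `w n`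
at the translates of `x` come from those of `η` at the translates of `M ^ n x mod 1` by `n` affine
steps, selected by the digits of `x` in reversed order. A register machine (`Run`) carries this out.
A forward pass reads the digits and piles them up in one integer, with the last digit in the leading
position; a backward pass takes them off again, restores the fractional parts, and applies the
affine steps. Multiplying a bounded value by an indicator is a clamp, and thresholds of integers are
ramps, so every step is a network of fixed size.

Only reading the digits of a real time is discontinuous. Steep ramps do it exactly unless `M ^ n t`
is within `1/8` of an integer (`Run.output_eq`). Translating the grid by `c / M ^ n` and evaluating
`E` and `η` at points translated accordingly moves this bad set. Of the three runs with
`c = 0, 1/3, 2/3` at most one is wrong at any given time (`far_or_far`), so their median is exact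
everywhere (`exists_net_add_iterate`).

The networks involved depend on the data only through weights, not through their size, and this is
what `UnifNet` records; continuous piecewise linear curves enter as sums of at most `m` hinges
(`hingeSum_of_encard_breakpoints_le`). Hence width and depth per step depend only on `M`, `p`, `N`
and `m`.
-/

open Filter Topology
open scoped Matrix

noncomputable section

namespace OpenCurve

/-! ### Fully connected networks over arbitrary finite index types -/

/-- `Hidden k g`: the map `g : ℝ^ι → ℝ^ω` is the output of the `k`-th hidden layer of a ReLU
network all of whose hidden layers are indexed by `ω`. This is `HiddenOutput` with arbitrary finite
index types, so that layers may be indexed by sums and products. -/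
inductive Hidden {ι ω : Type} [Fintype ι] [Fintype ω] : ℕ → ((ι → ℝ) → ω → ℝ) → Prop
  | first (K : Matrix ω ι ℝ) (b : ω → ℝ) : Hidden 1 (fun x i => max 0 ((K *ᵥ x + b) i))
  | next {k : ℕ} {g : (ι → ℝ) → ω → ℝ} (hg : Hidden k g) (K : Matrix ω ω ℝ) (b : ω → ℝ) :
      Hidden (k + 1) (fun x i => max 0 ((K *ᵥ g x + b) i))

section Hidden

variable {ι κ ω ω' : Type} [Fintype ι] [Fintype κ] [Fintype ω] [Fintype ω']

theorem Hidden.one_le {k : ℕ} {g : (ι → ℝ) → ω → ℝ} (h : Hidden k g) : 1 ≤ k := by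
  cases h <;> omega

theorem Hidden.exists_of_one {g : (ι → ℝ) → ω → ℝ} (h : Hidden 1 g) :
    ∃ (K : Matrix ω ι ℝ) (b : ω → ℝ), g = fun x i => max 0 ((K *ᵥ x + b) i) := by
  generalize hk : 1 = k at h
  cases h with
  | first K b => exact ⟨K, b, rfl⟩
  | next hg K b => have := hg.one_le; omega

theorem Hidden.exists_of_succ {k : ℕ} (hk : 1 ≤ k) {g : (ι → ℝ) → ω → ℝ}
    (h : Hidden (k + 1) g) :
    ∃ (g' : (ι → ℝ) → ω → ℝ) (K : Matrix ω ω ℝ) (b : ω → ℝ), Hidden k g' ∧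
      g = fun x i => max 0 ((K *ᵥ g' x + b) i) := by
  generalize hk' : k + 1 = l at h
  cases h with
  | first K b => omega
  | next hg K b =>
    obtain rfl : k = _ := Nat.succ.inj hk'
    exact ⟨_, K, b, hg, rfl⟩

theorem Hidden.nonneg {k : ℕ} {g : (ι → ℝ) → ω → ℝ} (h : Hidden k g) (x : ι → ℝ) (i : ω) :
    0 ≤ g x i := by
  cases h <;> exact le_max_left _ _

/-- Hidden layers are nonnegative, so an additional layer may simply copy them. -/
theorem Hidden.succ {k : ℕ} {g : (ι → ℝ) → ω → ℝ} (h : Hidden k g) : Hidden (k + 1) g := by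
  classical
  have h' := h.next (1 : Matrix ω ω ℝ) 0
  convert h' using 1
  funext x i
  simp [h.nonneg x i]

theorem Hidden.mono {k l : ℕ} (hkl : k ≤ l) {g : (ι → ℝ) → ω → ℝ} (h : Hidden k g) :
    Hidden l g := by
  induction hkl with
  | refl => exact h
  | step _ ih => exact ih.succ

theorem Hidden.reindex {k : ℕ} {g : (ι → ℝ) → ω → ℝ} (h : Hidden k g) (e : ω' ≃ ω) :
    Hidden k (fun x i => g x (e i)) := by
  induction h with
  | first K b => exact Hidden.first (fun i j => K (e i) j) (fun i => b (e i))
  | @next k g hg K b ih =>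
    convert ih.next (fun i j => K (e i) (e j)) (fun i => b (e i)) using 1
    funext x i
    simp only [Pi.add_apply, Matrix.mulVec, dotProduct]
    rw [← e.sum_comp]

/-- Networks of the same depth run in parallel. -/
theorem Hidden.sigma [DecidableEq κ] {w : κ → Type} [∀ a, Fintype (w a)] {k : ℕ} (hk : 1 ≤ k)
    {g : ∀ a, (ι → ℝ) → w a → ℝ} (h : ∀ a, Hidden k (g a)) :
    Hidden k (fun x (s : Σ a, w a) => g s.1 x s.2) := by
  induction k, hk using Nat.le_induction generalizing g with
  | base =>
    choose K b hg using fun a => (h a).exists_of_one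
    convert Hidden.first (ω := Σ a, w a) (fun s j => K s.1 s.2 j) (fun s => b s.1 s.2) using 1
    funext x s
    rw [hg]
    rfl
  | succ k hk ih =>
    choose g' K b hg' hg using fun a => (h a).exists_of_succ hk
    convert (ih hg').next (Matrix.blockDiagonal' K) (fun s => b s.1 s.2) using 1
    funext x s
    obtain ⟨a, i⟩ := s
    rw [hg]
    simp only [Pi.add_apply, Matrix.mulVec, dotProduct]
    rw [Fintype.sum_sigma, Finset.sum_eq_single a]
    · simp
    · intro c _ hc
      refine Finset.sum_eq_zero fun j _ => ?_
      rw [Matrix.blockDiagonal'_apply_ne _ _ _ (Ne.symm hc), zero_mul]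
    · simp

theorem Hidden.zero {k : ℕ} (hk : 1 ≤ k) : Hidden k (fun (_ : ι → ℝ) (_ : ω) => (0 : ℝ)) := by
  have h := Hidden.first (0 : Matrix ω ι ℝ) 0
  simp only [Matrix.zero_mulVec, add_zero, Pi.zero_apply, max_self] at h
  exact h.mono hk

/-- Replacing the input of a network by an affine image of a hidden layer of the same width
stacks the two networks. -/
theorem Hidden.comp {k l : ℕ} {g : (κ → ℝ) → ω → ℝ} {h : (ι → ℝ) → ω → ℝ} (hg : Hidden k g)
    (hh : Hidden l h) (K : Matrix κ ω ℝ) (b : κ → ℝ) :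
    Hidden (l + k) (fun x => g (K *ᵥ h x + b)) := by
  induction hg with
  | first K' b' =>
    convert hh.next (K' * K) (K' *ᵥ b + b') using 1
    funext x i
    beta_reduce
    rw [Matrix.mulVec_add, Matrix.mulVec_mulVec, add_assoc]
  | next _ K' b' ih => exact ih.next K' b'

theorem Hidden.hiddenOutput {d W k : ℕ} {g : (Fin d → ℝ) → Fin W → ℝ} (h : Hidden k g) :
    HiddenOutput W d k g := by
  induction h with
  | first K b => exact HiddenOutput.first K b
  | next _ K b ih => exact ih.next K b

end Hidden

/-- `Net W D f`: the map `f : ℝ^ι → ℝ^κ` is the output of a ReLU network with `D` hidden layers of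
`W` neurons each. -/
def Net {ι κ : Type} [Fintype ι] (W D : ℕ) (f : (ι → ℝ) → κ → ℝ) : Prop :=
  ∃ g : (ι → ℝ) → Fin W → ℝ, Hidden D g ∧
    ∃ (K : Matrix κ (Fin W) ℝ) (b : κ → ℝ), f = fun x => K *ᵥ g x + b

section Net

variable {ι κ ρ : Type} [Fintype ι] {W W' D D' : ℕ}

theorem Net.one_le {f : (ι → ℝ) → κ → ℝ} (h : Net W D f) : 1 ≤ D := by
  obtain ⟨g, hg, -⟩ := h
  exact hg.one_le

theorem Net.mono_depth {f : (ι → ℝ) → κ → ℝ} (h : Net W D f) (hD : D ≤ D') : Net W D' f := by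
  obtain ⟨g, hg, r⟩ := h
  exact ⟨g, hg.mono hD, r⟩

theorem Net.of_hidden {ω : Type} [Fintype ω] {g : (ι → ℝ) → ω → ℝ} (hg : Hidden D g)
    (hW : Fintype.card ω = W) (K : Matrix κ ω ℝ) (b : κ → ℝ) :
    Net W D (fun x => K *ᵥ g x + b) := by
  have e : Fin W ≃ ω := (Fintype.equivFinOfCardEq hW).symm
  refine ⟨_, hg.reindex e, fun i j => K i (e j), b, ?_⟩
  funext x i
  simp only [Pi.add_apply, Matrix.mulVec, dotProduct]
  rw [← e.sum_comp]

/-- A network is widened by neurons that are constantly zero. -/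
theorem Net.mono_width {f : (ι → ℝ) → κ → ℝ} (h : Net W D f) (hW : W ≤ W') : Net W' D f := by
  have hD := h.one_le
  obtain ⟨g, hg, K, b, rfl⟩ := h
  let w : Bool → Type := fun s => Fin (cond s W (W' - W))
  let G : ∀ s : Bool, (ι → ℝ) → w s → ℝ := fun s =>
    match s with
    | true => g
    | false => fun _ _ => 0
  have hG : ∀ s, Hidden D (G s) := by
    rintro (_ | _)
    · exact Hidden.zero hD
    · exact hg
  have hcard : Fintype.card (Σ s, w s) = W' := by
    rw [Fintype.card_sigma, Fintype.sum_bool]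
    simp only [w, Fintype.card_fin, cond_true, cond_false]
    omega
  have h := Net.of_hidden (Hidden.sigma hD hG) hcard
    (fun i s => match s with
      | ⟨true, j⟩ => K i j
      | ⟨false, _⟩ => 0) b
  convert h using 1
  funext x i
  simp only [Pi.add_apply, Matrix.mulVec, dotProduct]
  rw [Fintype.sum_sigma, Fintype.sum_bool]
  simp [G, w]

theorem Net.mono {f : (ι → ℝ) → κ → ℝ} (h : Net W D f) (hW : W ≤ W') (hD : D ≤ D') :
    Net W' D' f :=
  (h.mono_width hW).mono_depth hD

theorem Net.comp [Fintype κ] {f : (ι → ℝ) → κ → ℝ} {g : (κ → ℝ) → ρ → ℝ} (hg : Net W D' g)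
    (hf : Net W D f) : Net W (D + D') (fun x => g (f x)) := by
  obtain ⟨u, hu, K, b, rfl⟩ := hf
  obtain ⟨v, hv, K', b', rfl⟩ := hg
  exact ⟨_, hv.comp hu K b, K', b', rfl⟩

/-- The components of a map may be computed by separate networks. -/
theorem Net.pi [Fintype κ] {f : (ι → ℝ) → κ → ℝ} (hD : 1 ≤ D)
    (h : ∀ a, Net W D (fun x (_ : Unit) => f x a)) : Net (Fintype.card κ * W) D f := by
  classical
  choose g hg K b hf using h
  have h := Net.of_hidden (W := Fintype.card κ * W) (Hidden.sigma hD hg) (by simp)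
    (fun a s => if s.1 = a then K a () s.2 else 0) (fun a => b a ())
  convert h using 1
  funext x a
  have := congrFun (congrFun (hf a) x) ()
  beta_reduce at this
  rw [this]
  simp only [Pi.add_apply, Matrix.mulVec, dotProduct]
  rw [Fintype.sum_sigma, Finset.sum_eq_single a]
  · simp
  · intro c _ hc
    simp [hc]
  · simp

theorem Net.affine [Fintype κ] {f : (ι → ℝ) → κ → ℝ} (h : Net W D f)
    (L : Matrix ρ κ ℝ) (b : ρ → ℝ) : Net W D (fun x => L *ᵥ f x + b) := by
  obtain ⟨g, hg, K, c, rfl⟩ := h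
  refine ⟨g, hg, L * K, L *ᵥ c + b, ?_⟩
  funext x
  rw [Matrix.mulVec_add, Matrix.mulVec_mulVec, add_assoc]

theorem Net.max_zero {f : (ι → ℝ) → ℝ} (hW : 1 ≤ W) (h : Net W D (fun x (_ : Unit) => f x)) :
    Net W (D + 1) (fun x (_ : Unit) => max 0 (f x)) := by
  obtain ⟨g, hg, K, b, hf⟩ := h
  -- all neurons of the new layer agree, and the first one is read out
  refine ⟨_, hg.next (fun _ j => K () j) (fun _ => b ()),
    fun _ j => if j = ⟨0, hW⟩ then 1 else 0, 0, ?_⟩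
  funext x u
  have := congrFun (congrFun hf x) ()
  beta_reduce at this
  rw [this]
  simp [Matrix.mulVec, dotProduct]

/-- A coordinate is the difference of its positive and its negative part. -/
theorem Net.coord (i : ι) : Net 2 1 (fun (x : ι → ℝ) (_ : Unit) => x i) := by
  classical
  refine ⟨_, Hidden.first (fun s j => if j = i then (if s = 0 then 1 else -1) else 0) 0,
    fun _ s => if s = 0 then 1 else -1, 0, ?_⟩
  funext x u
  simp only [Pi.add_apply, Matrix.mulVec, dotProduct, Fin.sum_univ_two]
  simp only [ite_mul, zero_mul, Finset.sum_ite_eq', Finset.mem_univ, if_true, Pi.zero_apply]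
  rcases le_total 0 (x i) with h | h <;> simp [h]

theorem Net.const (c : ℝ) : Net 1 1 (fun (_ : ι → ℝ) (_ : Unit) => c) := by
  refine ⟨_, Hidden.zero le_rfl, 0, fun _ => c, ?_⟩
  funext x u
  simp

end Net

/-! ### Families of functions realized with uniform width and depth -/

/-- The functions `F θ : ℝ^ι → ℝ` are realized by networks of one common width and one common
depth. -/
def UnifNet {Θ : Type*} {ι : Type} [Fintype ι] (F : Θ → (ι → ℝ) → ℝ) : Prop :=
  ∃ W D : ℕ, 1 ≤ W ∧ 1 ≤ D ∧ ∀ θ, Net W D (fun x (_ : Unit) => F θ x)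

namespace UnifNet

variable {Θ : Type*} {ι : Type} [Fintype ι] {F G : Θ → (ι → ℝ) → ℝ}

theorem coord (i : ι) : UnifNet (fun (_ : Θ) (x : ι → ℝ) => x i) :=
  ⟨2, 1, by norm_num, le_rfl, fun _ => Net.coord i⟩

theorem const (c : Θ → ℝ) : UnifNet (fun (θ : Θ) (_ : ι → ℝ) => c θ) :=
  ⟨1, 1, le_rfl, le_rfl, fun θ => Net.const (c θ)⟩

theorem smul (hF : UnifNet F) (c : Θ → ℝ) : UnifNet (fun θ x => c θ * F θ x) := by
  obtain ⟨W, D, hW, hD, h⟩ := hF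
  refine ⟨W, D, hW, hD, fun θ => ?_⟩
  convert (h θ).affine (ρ := Unit) (fun _ _ => c θ) 0 using 1
  funext x u
  simp [Matrix.mulVec, dotProduct]

theorem max_zero (hF : UnifNet F) : UnifNet (fun θ x => max 0 (F θ x)) := by
  obtain ⟨W, D, hW, hD, h⟩ := hF
  exact ⟨W, D + 1, hW, by omega, fun θ => (h θ).max_zero hW⟩

/-- A family of maps with uniformly realized components is realized with a common depth and with
any sufficiently large common width. -/
theorem exists_net_pi {κ : Type} [Fintype κ] {F : Θ → (ι → ℝ) → κ → ℝ}
    (h : ∀ a, UnifNet (fun θ x => F θ x a)) :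
    ∃ W D : ℕ, ∀ W', W ≤ W' → ∀ θ, Net W' D (F θ) := by
  choose W D hW hD h using h
  refine ⟨Fintype.card κ * ∑ a, W a, 1 + ∑ a, D a, fun W' hW' θ => ?_⟩
  refine (Net.pi (by omega) fun a => (h a θ).mono ?_ ?_).mono_width hW'
  · exact Finset.single_le_sum (f := W) (fun _ _ => Nat.zero_le _) (Finset.mem_univ a)
  · have := Finset.single_le_sum (f := D) (fun _ _ => Nat.zero_le _) (Finset.mem_univ a)
    omega

theorem fintype_sum {κ : Type} [Fintype κ] {F : κ → Θ → (ι → ℝ) → ℝ} (h : ∀ a, UnifNet (F a)) :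
    UnifNet (fun θ x => ∑ a, F a θ x) := by
  obtain ⟨W, D, h⟩ := exists_net_pi (F := fun θ x a => F a θ x) h
  refine ⟨W + 1, D + 1, by omega, by omega, fun θ => ?_⟩
  convert ((h (W + 1) (by omega) θ).mono_depth (D' := D + 1) (by omega)).affine (ρ := Unit)
    (fun _ _ => 1) 0 using 1
  funext x u
  simp [Matrix.mulVec, dotProduct]

theorem sum {κ : Type} (s : Finset κ) {F : κ → Θ → (ι → ℝ) → ℝ} (h : ∀ a, UnifNet (F a)) :
    UnifNet (fun θ x => ∑ a ∈ s, F a θ x) := by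
  simp only [← Finset.sum_coe_sort s]
  exact fintype_sum fun a => h a

theorem add (hF : UnifNet F) (hG : UnifNet G) : UnifNet (fun θ x => F θ x + G θ x) := by
  have := fintype_sum (κ := Bool) (F := fun b => bif b then F else G)
    (by rintro (_ | _) <;> assumption)
  simpa using this

theorem sub (hF : UnifNet F) (hG : UnifNet G) : UnifNet (fun θ x => F θ x - G θ x) := by
  convert hF.add (hG.smul fun _ => -1) using 3
  ring

theorem max (hF : UnifNet F) (hG : UnifNet G) : UnifNet (fun θ x => max (F θ x) (G θ x)) := by
  convert hF.add (hG.sub hF).max_zero using 3 with θ x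
  rcases le_total (F θ x) (G θ x) with h | h <;> simp [h]

theorem min (hF : UnifNet F) (hG : UnifNet G) : UnifNet (fun θ x => min (F θ x) (G θ x)) := by
  convert hF.sub (hF.sub hG).max_zero using 3 with θ x
  rcases le_total (F θ x) (G θ x) with h | h <;> simp [h]

end UnifNet

/-- Iterating networks of the same width keeps the width, and the depth grows linearly. -/
theorem Net.loop {ι σ : Type} [Fintype ι] [Fintype σ] {W D D₀ : ℕ}
    {s : ℕ → (ι → ℝ) → σ → ℝ} {φ : ℕ → (σ → ℝ) → σ → ℝ} (h₀ : Net W D₀ (s 0))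
    (hφ : ∀ j, Net W D (φ j)) (hs : ∀ j x, s (j + 1) x = φ j (s j x)) (n : ℕ) :
    Net W (D₀ + n * D) (s n) := by
  induction n with
  | zero => simpa using h₀
  | succ n ih =>
    have : s (n + 1) = fun x => φ n (s n x) := funext (hs n)
    rw [this, Nat.succ_mul, ← add_assoc]
    exact (hφ n).comp ih

theorem Net.isRealizedBy {p W D : ℕ} {γ : ℝ → Fin p → ℝ}
    (h : Net W D (fun x : Fin 1 → ℝ => γ (x 0))) : IsRealizedBy γ W D := by
  obtain ⟨g, hg, K, b, hf⟩ := h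
  exact ⟨g, hg.hiddenOutput, K, b, hf⟩

/-! ### Continuous piecewise linear curves as sums of ReLU hinges -/

section Hinges

variable {p : ℕ}

/-- `HingeSum m f`: the curve `f` is a constant plus `m` hinges `max 0 (t - τ k) • w k`. -/
def HingeSum (m : ℕ) (f : ℝ → Fin p → ℝ) : Prop :=
  ∃ (b : Fin p → ℝ) (τ : Fin m → ℝ) (w : Fin m → Fin p → ℝ),
    ∀ t, f t = b + ∑ k, max 0 (t - τ k) • w k

theorem HingeSum.continuous {m : ℕ} {f : ℝ → Fin p → ℝ} (h : HingeSum m f) : Continuous f := by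
  obtain ⟨b, τ, w, h⟩ := h
  rw [funext h]
  fun_prop

/-- A curve without breakpoints in a connected open set is affine there. -/
theorem exists_affine_of_disjoint_breakpoints {f : ℝ → Fin p → ℝ} {S : Set ℝ} (hS : IsOpen S)
    (hS' : IsPreconnected S) (h : ∀ t ∈ S, t ∉ breakpoints f) :
    ∃ u v : Fin p → ℝ, ∀ t ∈ S, f t = u + t • v := by
  rcases S.eq_empty_or_nonempty with rfl | ⟨t₀, ht₀⟩
  · exact ⟨0, 0, by simp⟩
  have hloc : ∀ t ∈ S, ∃ u v : Fin p → ℝ, f =ᶠ[𝓝 t] fun s => u + s • v := by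
    intro t ht
    exact not_not.1 (h t ht)
  have hd : ∀ (u v : Fin p → ℝ) (t : ℝ), HasDerivAt (fun s : ℝ => u + s • v) v t := by
    intro u v t
    simpa using ((hasDerivAt_id t).smul_const v).const_add u
  have h1 : ∀ t ∈ S, DifferentiableAt ℝ f t ∧ ∃ v, deriv f =ᶠ[𝓝 t] fun _ => v := by
    intro t ht
    obtain ⟨u, v, huv⟩ := hloc t ht
    refine ⟨huv.differentiableAt_iff.2 (hd u v t).differentiableAt, v, ?_⟩
    filter_upwards [huv.eventuallyEq_nhds] with s hs
    rw [hs.deriv_eq, (hd u v s).deriv]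
  have h2 : ∀ t ∈ S, deriv f t = deriv f t₀ := by
    intro t ht
    refine hS.is_const_of_deriv_eq_zero hS' ?_ ?_ ht ht₀
    · intro s hs
      obtain ⟨v, hv⟩ := (h1 s hs).2
      exact (hv.differentiableAt_iff.2 (differentiableAt_const v)).differentiableWithinAt
    · intro s hs
      obtain ⟨v, hv⟩ := (h1 s hs).2
      simp [hv.deriv_eq]
  refine ⟨f t₀ - t₀ • deriv f t₀, deriv f t₀, fun t ht => ?_⟩
  have h3 : ∀ s ∈ S, HasDerivAt (fun s => f s - s • deriv f t₀) 0 s := by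
    intro s hs
    have := (h1 s hs).1.hasDerivAt.sub (by simpa using hd 0 (deriv f t₀) s)
    rwa [h2 s hs, sub_self] at this
  have h4 := hS.is_const_of_deriv_eq_zero hS'
    (fun s hs => (h3 s hs).differentiableAt.differentiableWithinAt)
    (fun s hs => (h3 s hs).deriv) ht ht₀
  rw [← h4]
  abel

/-- Finitely many breakpoints are isolated, so the curve is affine on either side of `b`.
Subtracting the hinge at `b` that carries the jump of the slope removes the breakpoint `b` and
creates no other one. -/
theorem exists_breakpoints_sub_hinge {f : ℝ → Fin p → ℝ} (hf : Continuous f)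
    (hfin : (breakpoints f).Finite) (b : ℝ) :
    ∃ w : Fin p → ℝ, breakpoints (fun t => f t - max 0 (t - b) • w) ⊆ breakpoints f \ {b} := by
  have hev : ∀ᶠ s in 𝓝[≠] b, s ∉ breakpoints f := by
    have : (breakpoints f \ {b})ᶜ ∈ 𝓝 b :=
      (hfin.sdiff.isClosed.isOpen_compl).mem_nhds (by simp)
    rw [eventually_nhdsWithin_iff]
    filter_upwards [this] with s hs hsb hs'
    exact hs ⟨hs', hsb⟩
  rw [eventually_nhdsWithin_iff, Metric.eventually_nhds_iff_ball] at hev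
  obtain ⟨ε, hε, hev⟩ := hev
  have hev' : ∀ s, |s - b| < ε → s ≠ b → s ∉ breakpoints f := fun s hs =>
    hev s (by simpa [Real.dist_eq] using hs)
  obtain ⟨u₁, v₁, h₁⟩ := exists_affine_of_disjoint_breakpoints (f := f) isOpen_Ioo
    (isPreconnected_Ioo (a := b - ε) (b := b)) fun t ht =>
      hev' t (by rw [abs_lt]; constructor <;> linarith [ht.1, ht.2]) ht.2.ne
  obtain ⟨u₂, v₂, h₂⟩ := exists_affine_of_disjoint_breakpoints (f := f) isOpen_Ioo
    (isPreconnected_Ioo (a := b) (b := b + ε)) fun t ht =>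
      hev' t (by rw [abs_lt]; constructor <;> linarith [ht.1, ht.2]) ht.1.ne'
  have hb₁ : f b = u₁ + b • v₁ := by
    refine tendsto_nhds_unique_of_eventuallyEq (l := 𝓝[<] b)
      (hf.continuousAt.tendsto.mono_left nhdsWithin_le_nhds)
      ((by fun_prop : Continuous fun s : ℝ => u₁ + s • v₁).continuousAt.tendsto.mono_left
        nhdsWithin_le_nhds) ?_
    filter_upwards [Ioo_mem_nhdsLT (by linarith : b - ε < b)] with s hs using h₁ s hs
  have hb₂ : f b = u₂ + b • v₂ := by
    refine tendsto_nhds_unique_of_eventuallyEq (l := 𝓝[>] b)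
      (hf.continuousAt.tendsto.mono_left nhdsWithin_le_nhds)
      ((by fun_prop : Continuous fun s : ℝ => u₂ + s • v₂).continuousAt.tendsto.mono_left
        nhdsWithin_le_nhds) ?_
    filter_upwards [Ioo_mem_nhdsGT (by linarith : b < b + ε)] with s hs using h₂ s hs
  have hb : b ∉ breakpoints (fun t => f t - max 0 (t - b) • (v₂ - v₁)) := by
    refine not_not.2 ⟨u₁, v₁, ?_⟩
    filter_upwards [Ioo_mem_nhds (by linarith : b - ε < b) (by linarith : b < b + ε)] with s hs
    rcases lt_trichotomy s b with hsb | rfl | hsb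
    · rw [h₁ s ⟨hs.1, hsb⟩, max_eq_left (by linarith)]
      simp
    · simp [hb₁]
    · rw [h₂ s ⟨hsb, hs.2⟩, max_eq_right (by linarith)]
      funext i
      have := congrFun (hb₁.symm.trans hb₂) i
      simp only [Pi.add_apply, Pi.sub_apply, Pi.smul_apply, smul_eq_mul] at this ⊢
      linarith
  refine ⟨v₂ - v₁, fun t ht => ?_⟩
  have htb : t ≠ b := fun h => hb (h ▸ ht)
  refine ⟨fun hft => ht ?_, htb⟩
  obtain ⟨u, v, huv⟩ := hft
  rcases lt_or_gt_of_ne htb with h | h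
  · refine ⟨u, v, ?_⟩
    filter_upwards [huv, Iio_mem_nhds h] with s hs hsb
    rw [hs, max_eq_left (by linarith [Set.mem_Iio.1 hsb])]
    simp
  · refine ⟨u + b • (v₂ - v₁), v - (v₂ - v₁), ?_⟩
    filter_upwards [huv, Ioi_mem_nhds h] with s hs hsb
    rw [hs, max_eq_right (by linarith [Set.mem_Ioi.1 hsb])]
    module

/-- A continuous curve with at most `m` breakpoints that is constant near `-∞` is a sum of `m`
hinges: the breakpoints are removed one at a time. -/
theorem hingeSum_of_encard_breakpoints_le (m : ℕ) {f : ℝ → Fin p → ℝ} (hf : Continuous f)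
    (hm : (breakpoints f).encard ≤ m) {c : Fin p → ℝ} {T : ℝ} (hc : ∀ t ≤ T, f t = c) :
    HingeSum m f := by
  induction m generalizing f T with
  | zero =>
    have h0 : breakpoints f = ∅ := by simpa using hm
    obtain ⟨u, v, h⟩ := exists_affine_of_disjoint_breakpoints (f := f) isOpen_univ
      isPreconnected_univ (by simp [h0])
    have hv : v = 0 := by
      have h1 := hc T le_rfl
      have h2 := hc (T - 1) (by linarith)
      rw [h _ trivial] at h1 h2
      have := h1.trans h2.symm
      funext i
      have := congrFun this i
      simp only [Pi.add_apply, Pi.smul_apply, smul_eq_mul] at this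
      simp only [Pi.zero_apply]
      linarith
    exact ⟨u, Fin.elim0, Fin.elim0, fun t => by simp [h t trivial, hv]⟩
  | succ m ih =>
    have hfin : (breakpoints f).Finite := Set.finite_of_encard_le_coe hm
    obtain ⟨b, hb⟩ : ∃ b, (breakpoints f \ {b}).encard ≤ m := by
      rcases (breakpoints f).eq_empty_or_nonempty with h | ⟨b, hb⟩
      · exact ⟨0, by simp [h]⟩
      · refine ⟨b, ?_⟩
        have := Set.encard_sdiff_singleton_add_one hb
        rw [← this] at hm
        push_cast at hm
        exact (ENat.add_le_add_iff_right (by simp)).1 hm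
    obtain ⟨w, hw⟩ := exists_breakpoints_sub_hinge hf hfin b
    obtain ⟨u, τ, w', h⟩ := ih (f := fun t => f t - max 0 (t - b) • w) (T := min T b) (by fun_prop)
      ((Set.encard_le_encard hw).trans hb) fun t ht => by
        rw [hc t (ht.trans (min_le_left _ _)),
          max_eq_left (by linarith [ht.trans (min_le_right _ _)])]
        simp
    refine ⟨u, Fin.cons b τ, Fin.cons w w', fun t => ?_⟩
    rw [Fin.sum_univ_succ]
    simp only [Fin.cons_zero, Fin.cons_succ]
    rw [add_left_comm, ← h t]
    exact (add_sub_cancel _ _).symm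

end Hinges

/-! ### Ramps and gates -/

/-- The ramp that rises from `0` to `1` on the unit interval. -/
def ramp (s : ℝ) : ℝ := max 0 s - max 0 (s - 1)

/-- The truncation of `v` to `[-k, k]`. With `|v| ≤ K` and `b ∈ {0, 1}`, the value of
`clamp v (K * b)` is `b * v`, so clamping multiplies by an indicator. -/
def clamp (v k : ℝ) : ℝ := max (-k) (min v k)

theorem ramp_of_one_le {s : ℝ} (h : 1 ≤ s) : ramp s = 1 := by
  rw [ramp, max_eq_right (by linarith), max_eq_right (by linarith)]
  ring

theorem ramp_of_nonpos {s : ℝ} (h : s ≤ 0) : ramp s = 0 := by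
  rw [ramp, max_eq_left h, max_eq_left (by linarith), sub_zero]

/-- A sufficiently steep ramp at an integer `k` compares `k` with the integer part. -/
theorem ramp_mul_sub {lam u : ℝ} (hlam : 0 < lam) {k : ℤ} (h : 1 ≤ |lam * (u - k)|) :
    ramp (lam * (u - k)) = if k ≤ ⌊u⌋ then 1 else 0 := by
  split_ifs with hk
  · rw [Int.le_floor] at hk
    rw [abs_of_nonneg (mul_nonneg hlam.le (by linarith))] at h
    exact ramp_of_one_le h
  · rw [Int.le_floor, not_le] at hk
    exact ramp_of_nonpos (mul_nonpos_of_nonneg_of_nonpos hlam.le (by linarith))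

/-- At integers, a ramp of slope one is a threshold. -/
theorem ramp_intCast_sub (y k : ℤ) :
    ramp ((y : ℝ) - k + 1) = if k ≤ y then 1 else 0 := by
  split_ifs with hk
  · have : (k : ℝ) ≤ y := by exact_mod_cast hk
    exact ramp_of_one_le (by linarith)
  · have : (y : ℝ) + 1 ≤ k := by exact_mod_cast (by omega : y + 1 ≤ k)
    exact ramp_of_nonpos (by linarith)

theorem clamp_zero (v : ℝ) : clamp v 0 = 0 := by
  simp [clamp]

theorem clamp_of_abs_le {v k : ℝ} (h : |v| ≤ k) : clamp v k = v := by
  rw [abs_le] at h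
  rw [clamp, min_eq_left h.2, max_eq_right h.1]

theorem clamp_mul_ite {v k : ℝ} (h : |v| ≤ k) (P : Prop) [Decidable P] :
    clamp v (k * if P then 1 else 0) = if P then v else 0 := by
  split_ifs
  · rw [mul_one, clamp_of_abs_le h]
  · rw [mul_zero, clamp_zero]

theorem ite_sub_ite_succ (d k : ℤ) :
    ((if k ≤ d then 1 else 0) - (if k + 1 ≤ d then 1 else 0) : ℝ) = if d = k then 1 else 0 := by
  rcases lt_trichotomy d k with h | h | h
  · rw [if_neg (by omega), if_neg (by omega), if_neg (by omega), sub_zero]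
  · rw [if_pos (by omega), if_neg (by omega), if_pos h, sub_zero]
  · rw [if_pos (by omega), if_pos (by omega), if_neg (by omega), sub_self]

/-- Counting the integers `k` of an interval with `k ≤ d` recovers `d`. -/
theorem sum_Icc_ite_le {a b d : ℤ} (h₁ : a - 1 ≤ d) (h₂ : d ≤ b) :
    (∑ k ∈ Finset.Icc a b, if k ≤ d then (1 : ℝ) else 0) = d - a + 1 := by
  rw [Finset.sum_boole]
  have : (Finset.Icc a b).filter (· ≤ d) = Finset.Icc a d := by
    ext k
    simp only [Finset.mem_filter, Finset.mem_Icc]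
    omega
  rw [this, Int.card_Icc]
  have h : (((d + 1 - a).toNat : ℤ) : ℝ) = ((d + 1 - a : ℤ) : ℝ) := by
    rw [Int.toNat_of_nonneg (by omega)]
  push_cast at h ⊢
  rw [h]
  ring

theorem UnifNet.ramp {Θ : Type*} {ι : Type} [Fintype ι] {F : Θ → (ι → ℝ) → ℝ} (hF : UnifNet F) :
    UnifNet (fun θ x => ramp (F θ x)) :=
  hF.max_zero.sub (hF.sub (UnifNet.const fun _ => 1)).max_zero

theorem UnifNet.clamp {Θ : Type*} {ι : Type} [Fintype ι] {F G : Θ → (ι → ℝ) → ℝ}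
    (hF : UnifNet F) (hG : UnifNet G) : UnifNet (fun θ x => clamp (F θ x) (G θ x)) := by
  have h : UnifNet (fun θ x => -G θ x) := by
    simpa using hG.smul fun _ => -1
  exact h.max (hF.min hG)

theorem HingeSum.unifNet {Θ : Type*} {ι : Type} [Fintype ι] {p m : ℕ} {f : Θ → ℝ → Fin p → ℝ}
    (hf : ∀ θ, HingeSum m (f θ)) {F : Θ → (ι → ℝ) → ℝ} (hF : UnifNet F) (a : Fin p) :
    UnifNet (fun θ x => f θ (F θ x) a) := by
  choose b τ w h using hf
  have : UnifNet (fun θ x => b θ a + ∑ k, w θ k a * max 0 (F θ x - τ θ k)) :=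
    (UnifNet.const _).add <| UnifNet.fintype_sum fun k =>
      (hF.sub (UnifNet.const fun θ => τ θ k)).max_zero.smul fun θ => w θ k a
  convert this using 3 with θ x
  rw [h]
  simp [mul_comm]

/-! ### The register machine -/

/-- The data of one run of the machine: the mask, the two curves `E` and `η` that drive the
iteration `ξ ↦ Vξ + E` started at `η`, the number `n` of iterations, the translation `c` of the
grid, and a bound `K` for the values of the gates. -/
structure Run (p m : ℕ) where
  A : ℤ →₀ Matrix (Fin p) (Fin p) ℝ
  E : ℝ → Fin p → ℝ
  η : ℝ → Fin p → ℝ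
  hE : HingeSum m E
  hη : HingeSum m η
  n : ℕ
  c : ℝ
  K : ℝ

/-- The integer translates that meet the window `[-N, N]` from a point of `[0, 2)`. -/
abbrev Window (N : ℕ) : Type := ↥(Finset.Icc (-(N : ℤ) - 1) N)

/-- The registers: the time, its fractional part on the current grid, the word of digits (an
integer), and the values of a curve at the translates of the current point. -/
abbrev Reg (p N : ℕ) : Type := Fin 3 ⊕ (Window N × Fin p)

namespace Run

variable {p m : ℕ} (M N : ℕ)

/-- The slope of the ramps that read digits from the time. -/
def slope (R : Run p m) : ℝ := 8 * (M : ℝ) ^ R.n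

/-- Loads the translated time and its fractional part. The integer part of a time in
`[-N - 1, N + 1)` is found by counting the integers of `[-N, N]` below it. -/
def init (R : Run p m) (x : Fin 1 → ℝ) : Reg p N → ℝ :=
  Sum.elim
    ![x 0 - R.c / (M : ℝ) ^ R.n,
      x 0 - R.c / (M : ℝ) ^ R.n + (N + 1) -
        ∑ k ∈ Finset.Icc (-(N : ℤ)) N,
          ramp (R.slope M * (x 0 - R.c / (M : ℝ) ^ R.n - (k : ℝ))),
      0]
    (fun _ => 0)

/-- The next `M`-ary digit of the fractional part. -/
def digit (R : Run p m) (s : Reg p N → ℝ) : ℝ :=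
  ∑ k ∈ Finset.Icc (1 : ℤ) (M - 1), ramp (R.slope M * (M * s (.inl 1) - (k : ℝ)))

/-- Moves the next digit from the fractional part to the top of the word of digits. The values are
not in use during the forward pass. -/
def forward (R : Run p m) (j : ℕ) (s : Reg p N → ℝ) : Reg p N → ℝ :=
  Sum.elim
    ![s (.inl 0), M * s (.inl 1) - R.digit M N s, s (.inl 2) + (M : ℝ) ^ j * R.digit M N s]
    (fun _ => 0)

/-- Loads the values of the initial curve. -/
def load (R : Run p m) (s : Reg p N → ℝ) : Reg p N → ℝ :=
  Sum.elim ![s (.inl 0), s (.inl 1), s (.inl 2)]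
    (fun i => R.η (s (.inl 1) + (R.c + ((i.1 : ℤ) : ℝ))) i.2)

/-- The indicator that the top digit of the word, at position `j`, is at least `k`. -/
def thr (j : ℕ) (k : ℤ) (s : Reg p N → ℝ) : ℝ :=
  ramp (s (.inl 2) - (k * (M : ℝ) ^ j - 1))

/-- The top digit, at position `j`, of the word. -/
def top (j : ℕ) (s : Reg p N → ℝ) : ℝ :=
  ∑ k ∈ Finset.Icc (1 : ℤ) (M - 1), thr M N j k s

/-- Removes the top digit from the word, restores the previous fractional part, and applies one
step `ξ ↦ Vξ + E` to the values. -/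
def backward (R : Run p m) (j : ℕ) (s : Reg p N → ℝ) : Reg p N → ℝ :=
  Sum.elim
    ![s (.inl 0), (M : ℝ)⁻¹ * (s (.inl 1) + top M N j s), s (.inl 2) - (M : ℝ) ^ j * top M N j s]
    (fun i =>
      R.E ((M : ℝ)⁻¹ * (s (.inl 1) + top M N j s) +
          (R.c * (M : ℝ) ^ j / (M : ℝ) ^ R.n + ((i.1 : ℤ) : ℝ))) i.2 +
        ∑ k ∈ Finset.Icc (0 : ℤ) (M - 1), ∑ i' : Window N, ∑ a' : Fin p,
          R.A (k + M * i.1 - i') i.2 a' *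
            clamp (s (.inr (i', a'))) (R.K * (thr M N j k s - thr M N j (k + 1) s)))

/-- Selects the value at the translate given by the integer part of the time. Outside the window
all gates are closed and the result is zero, whatever the registers contain. -/
def select (R : Run p m) (s : Reg p N → ℝ) (a : Fin p) : ℝ :=
  ∑ i : Window N, clamp (s (.inr (i, a)))
    (R.K * (ramp (R.slope M * (s (.inl 0) - ((i : ℤ) : ℝ))) -
      ramp (R.slope M * (s (.inl 0) - ((i : ℤ) + 1 : ℝ)))))

/-- The registers after `j` forward steps. -/
def forwardState (R : Run p m) (x : Fin 1 → ℝ) : ℕ → Reg p N → ℝ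
  | 0 => R.init M N x
  | j + 1 => R.forward M N j (R.forwardState x j)

/-- The registers after the forward pass and `l` backward steps; the step numbered `l` handles the
digit at position `n - 1 - l`. -/
def backwardState (R : Run p m) (x : Fin 1 → ℝ) : ℕ → Reg p N → ℝ
  | 0 => R.load N (R.forwardState M N x R.n)
  | l + 1 => R.backward M N (R.n - 1 - l) (R.backwardState x l)

/-- The result of a run. -/
def output (R : Run p m) (x : Fin 1 → ℝ) : Fin p → ℝ :=
  R.select M N (R.backwardState M N x R.n)

theorem unifNet_init (r : Reg p N) :
    UnifNet (fun (R : Run p m) (x : Fin 1 → ℝ) => R.init M N x r) := by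
  have h : UnifNet (fun (R : Run p m) (x : Fin 1 → ℝ) => x 0 - R.c / (M : ℝ) ^ R.n) :=
    (UnifNet.coord 0).sub (UnifNet.const _)
  rcases r with r | r
  · fin_cases r
    · exact h
    · exact (h.add (UnifNet.const _)).sub <| UnifNet.sum _ fun k =>
        ((h.sub (UnifNet.const _)).smul _).ramp
    · exact UnifNet.const _
  · exact UnifNet.const _

theorem unifNet_forward (r : Reg p N) :
    UnifNet (fun (θ : Run p m × ℕ) s => θ.1.forward M N θ.2 s r) := by
  have h : UnifNet (fun (θ : Run p m × ℕ) (s : Reg p N → ℝ) => θ.1.digit M N s) :=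
    UnifNet.sum _ fun k =>
      ((((UnifNet.coord (Sum.inl 1 : Reg p N)).smul _).sub (UnifNet.const _)).smul _).ramp
  rcases r with r | r
  · fin_cases r
    · exact UnifNet.coord _
    · exact ((UnifNet.coord (Sum.inl 1 : Reg p N)).smul _).sub h
    · exact (UnifNet.coord (Sum.inl 2 : Reg p N)).add (h.smul fun θ => (M : ℝ) ^ θ.2)
  · exact UnifNet.const _

theorem unifNet_load (r : Reg p N) :
    UnifNet (fun (R : Run p m) s => R.load N s r) := by
  rcases r with r | r
  · fin_cases r <;> exact UnifNet.coord _
  · exact HingeSum.unifNet (fun R : Run p m => R.hη) ((UnifNet.coord (Sum.inl 1 : Reg p N)).add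
      (UnifNet.const fun R : Run p m => R.c + ((r.1 : ℤ) : ℝ))) r.2

theorem unifNet_backward (r : Reg p N) :
    UnifNet (fun (θ : Run p m × ℕ) s => θ.1.backward M N θ.2 s r) := by
  have ht : ∀ k : ℤ, UnifNet (fun (θ : Run p m × ℕ) (s : Reg p N → ℝ) => thr M N θ.2 k s) :=
    fun k => ((UnifNet.coord (Sum.inl 2 : Reg p N)).sub
      (UnifNet.const fun θ : Run p m × ℕ => k * (M : ℝ) ^ θ.2 - 1)).ramp
  have h : UnifNet (fun (θ : Run p m × ℕ) (s : Reg p N → ℝ) => top M N θ.2 s) :=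
    UnifNet.sum _ fun k => ht k
  have hx : UnifNet (fun (θ : Run p m × ℕ) (s : Reg p N → ℝ) =>
      (M : ℝ)⁻¹ * (s (.inl 1) + top M N θ.2 s)) :=
    ((UnifNet.coord (Sum.inl 1 : Reg p N)).add h).smul _
  rcases r with r | r
  · fin_cases r
    · exact UnifNet.coord _
    · exact hx
    · exact (UnifNet.coord (Sum.inl 2 : Reg p N)).sub (h.smul fun θ => (M : ℝ) ^ θ.2)
  · refine UnifNet.add (HingeSum.unifNet (fun θ : Run p m × ℕ => θ.1.hE)
      (hx.add (UnifNet.const _)) r.2) ?_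
    exact UnifNet.sum _ fun k => UnifNet.fintype_sum fun i' => UnifNet.fintype_sum fun a' =>
      UnifNet.smul (UnifNet.clamp (UnifNet.coord _)
        (((ht k).sub (ht (k + 1))).smul fun θ => θ.1.K))
        fun θ => θ.1.A (k + M * r.1 - i') r.2 a'

theorem unifNet_select (a : Fin p) :
    UnifNet (fun (R : Run p m) (s : Reg p N → ℝ) => R.select M N s a) :=
  UnifNet.fintype_sum fun _ => UnifNet.clamp (UnifNet.coord _)
    ((((((UnifNet.coord _).sub (UnifNet.const _)).smul _).ramp).sub
      (((UnifNet.coord _).sub (UnifNet.const _)).smul _).ramp).smul fun R : Run p m => R.K)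

/-- The machine is a network of constant width whose depth is linear in the number of steps. -/
theorem exists_net_output (p m : ℕ) : ∃ W D : ℕ, ∀ R : Run p m, Net W (D * (R.n + 1))
    (R.output M N) := by
  obtain ⟨W₁, D₁, h₁⟩ := UnifNet.exists_net_pi (unifNet_init (p := p) (m := m) M N)
  obtain ⟨W₂, D₂, h₂⟩ := UnifNet.exists_net_pi (unifNet_forward (p := p) (m := m) M N)
  obtain ⟨W₃, D₃, h₃⟩ := UnifNet.exists_net_pi (unifNet_load (p := p) (m := m) N)
  obtain ⟨W₄, D₄, h₄⟩ := UnifNet.exists_net_pi (unifNet_backward (p := p) (m := m) M N)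
  obtain ⟨W₅, D₅, h₅⟩ := UnifNet.exists_net_pi (unifNet_select (p := p) (m := m) M N)
  refine ⟨W₁ + W₂ + W₃ + W₄ + W₅, D₁ + D₂ + D₃ + D₄ + D₅, fun R => ?_⟩
  have hf := Net.loop (s := fun j x => R.forwardState M N x j)
    (h₁ (W₁ + W₂ + W₃ + W₄ + W₅) (by omega) R)
    (fun j => h₂ (W₁ + W₂ + W₃ + W₄ + W₅) (by omega) (R, j)) (fun j x => rfl) R.n
  have hl := (h₃ (W₁ + W₂ + W₃ + W₄ + W₅) (by omega) R).comp hf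
  have hb := Net.loop (s := fun l x => R.backwardState M N x l) hl
    (fun l => h₄ (W₁ + W₂ + W₃ + W₄ + W₅) (by omega) (R, R.n - 1 - l)) (fun j x => rfl) R.n
  refine ((h₅ (W₁ + W₂ + W₃ + W₄ + W₅) (by omega) R).comp hb).mono_depth ?_
  nlinarith [Nat.zero_le (R.n * D₁), Nat.zero_le (R.n * D₃), Nat.zero_le (R.n * D₅)]

end Run

/-! ### Digits -/

/-- The `M`-ary digit of `t` at position `j + 1` after the point. -/
def dig (M : ℕ) (t : ℝ) (j : ℕ) : ℤ := ⌊(M : ℝ) ^ (j + 1) * t⌋ - M * ⌊(M : ℝ) ^ j * t⌋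

/-- The integer whose `M`-ary digits are the first `j` digits of `t` after the point, in reversed
order: the digit found last is the leading one. -/
def word (M : ℕ) (t : ℝ) (j : ℕ) : ℤ := ∑ l ∈ Finset.range j, (M : ℤ) ^ l * dig M t l

section Digits

variable {M : ℕ} (hM : 2 ≤ M) (t : ℝ) (j : ℕ)

include hM

theorem dig_nonneg : 0 ≤ dig M t j := by
  have : (M : ℤ) * ⌊(M : ℝ) ^ j * t⌋ ≤ ⌊(M : ℝ) ^ (j + 1) * t⌋ := by
    rw [Int.le_floor]
    push_cast
    rw [pow_succ']
    have := Int.floor_le ((M : ℝ) ^ j * t)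
    have hM' : (0 : ℝ) ≤ M := by positivity
    nlinarith
  rw [dig]
  omega

theorem dig_le : dig M t j ≤ M - 1 := by
  have : ⌊(M : ℝ) ^ (j + 1) * t⌋ < M * (⌊(M : ℝ) ^ j * t⌋ + 1) := by
    rw [Int.floor_lt]
    push_cast
    rw [pow_succ']
    have := Int.lt_floor_add_one ((M : ℝ) ^ j * t)
    have hM' : (0 : ℝ) < M := by exact_mod_cast (by omega : 0 < M)
    nlinarith
  rw [dig]
  linarith

omit hM in
theorem mul_fract_eq : M * Int.fract ((M : ℝ) ^ j * t) =
    dig M t j + Int.fract ((M : ℝ) ^ (j + 1) * t) := by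
  rw [dig, Int.fract, Int.fract]
  push_cast
  ring

omit hM in
theorem word_succ : word M t (j + 1) = word M t j + (M : ℤ) ^ j * dig M t j :=
  Finset.sum_range_succ _ _

theorem word_nonneg : 0 ≤ word M t j :=
  Finset.sum_nonneg fun l _ => mul_nonneg (by positivity) (dig_nonneg hM t l)

theorem word_lt : word M t j < (M : ℤ) ^ j := by
  induction j with
  | zero => simp [word]
  | succ j ih =>
    rw [word_succ, pow_succ]
    have h := dig_le hM t j
    have : (0 : ℤ) < (M : ℤ) ^ j := by positivity
    nlinarith

/-- The leading digit of a word is found by integer comparisons. -/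
theorem mul_pow_le_word_iff (k : ℤ) : k * (M : ℤ) ^ j ≤ word M t (j + 1) ↔ k ≤ dig M t j := by
  have h₀ := word_nonneg hM t j
  have h₁ := word_lt hM t j
  have hp : (0 : ℤ) < (M : ℤ) ^ j := by positivity
  rw [word_succ]
  constructor
  · intro h
    by_contra! hk
    nlinarith [Int.add_one_le_iff.2 hk]
  · intro h
    nlinarith

end Digits

/-! ### The refinement operator on the window -/

section Refine

variable {p : ℕ} {M : ℕ} {A : ℤ →₀ Matrix (Fin p) (Fin p) ℝ}

/-- On a curve supported in the window, the refinement operator is a matrix acting on the values at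
the translates of a point. -/
theorem sum_mask_eq_sum_window {N : ℕ} {ξ : ℝ → Fin p → ℝ} (hξ : ∀ t, (N : ℝ) < |t| → ξ t = 0)
    {x : ℝ} (hx₀ : 0 ≤ x) (hx₂ : x < 2) (q : ℤ) :
    ∑ l ∈ A.support, A l *ᵥ ξ (x + q - l) = ∑ i : Window N, A (q - i) *ᵥ ξ (x + (i : ℤ)) := by
  rw [Finset.sum_coe_sort (Finset.Icc (-(N : ℤ) - 1) N)
    (fun i : ℤ => A (q - i) *ᵥ ξ (x + (i : ℝ)))]
  have hinj : Function.Injective fun i : ℤ => q - i := fun a b h => by simpa using h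
  have h₁ : ∑ i ∈ Finset.Icc (-(N : ℤ) - 1) N, A (q - i) *ᵥ ξ (x + (i : ℝ)) =
      ∑ l ∈ (Finset.Icc (-(N : ℤ) - 1) N).map ⟨_, hinj⟩, A l *ᵥ ξ (x + q - l) := by
    rw [Finset.sum_map]
    refine Finset.sum_congr rfl fun i _ => ?_
    simp only [Function.Embedding.coeFn_mk]
    congr 2
    push_cast
    ring
  rw [h₁]
  classical
  rw [Finset.sum_subset (Finset.subset_union_left
      (s₂ := (Finset.Icc (-(N : ℤ) - 1) N).map ⟨_, hinj⟩)),
    Finset.sum_subset (Finset.subset_union_right (s₁ := A.support)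
      (s₂ := (Finset.Icc (-(N : ℤ) - 1) N).map ⟨_, hinj⟩))]
  · intro l _ hl
    have hl' : ¬ (-(N : ℤ) - 1 ≤ q - l ∧ q - l ≤ N) := by
      intro h
      exact hl (Finset.mem_map.2 ⟨q - l, Finset.mem_Icc.2 h, by simp⟩)
    rw [hξ, Matrix.mulVec_zero]
    rw [not_and_or, not_le, not_le] at hl'
    rw [lt_abs]
    rcases hl' with h | h
    · right
      have : ((q : ℝ) - l) + 1 ≤ -(N : ℝ) - 1 := by exact_mod_cast Int.add_one_le_iff.2 h
      linarith
    · left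
      have : (N : ℝ) + 1 ≤ (q : ℝ) - l := by exact_mod_cast Int.add_one_le_iff.2 h
      linarith
  · intro l _ hl
    rw [Finsupp.notMem_support_iff.1 hl, Matrix.zero_mulVec]

theorem affineRefine_window {N : ℕ} {E ξ : ℝ → Fin p → ℝ}
    (hξ : ∀ t, (N : ℝ) < |t| → ξ t = 0) {x s : ℝ} {d i : ℤ} (hx₀ : 0 ≤ x) (hx₂ : x < 2)
    (hs : M * s = x + d) (a : Fin p) :
    affineRefine M A E ξ (s + i) a =
      E (s + i) a + ∑ i' : Window N, ∑ a' : Fin p,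
        A (d + M * i - i') a a' * ξ (x + (i' : ℤ)) a' := by
  have h : refine M A ξ (s + i) = ∑ l ∈ A.support, A l *ᵥ ξ (x + (d + M * i : ℤ) - l) := by
    refine Finset.sum_congr rfl fun l _ => ?_
    congr 2
    push_cast
    linear_combination hs
  rw [affineRefine, Pi.add_apply, Pi.add_apply, h, sum_mask_eq_sum_window hξ hx₀ hx₂, add_comm,
    Finset.sum_apply]
  rfl

end Refine

/-! ### Correctness of the register machine -/

namespace Run

variable {p m M N : ℕ}

/-- The time on the translated grid. -/
def time (R : Run p m) (M : ℕ) (x : Fin 1 → ℝ) : ℝ := x 0 - R.c / (M : ℝ) ^ R.n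

/-- The time is not close to the grid of step `M ^ (-n)`. -/
def Good (R : Run p m) (M : ℕ) (x : Fin 1 → ℝ) : Prop :=
  ∀ z : ℤ, 1 ≤ 8 * |(M : ℝ) ^ R.n * R.time M x - z|

theorem slope_pos (hM : 2 ≤ M) (R : Run p m) : 0 < R.slope M := by
  have : (0 : ℝ) < M := by exact_mod_cast (by omega : 0 < M)
  rw [slope]
  positivity

/-- A time that is not close to the finest grid is not close to the coarser ones either. -/
theorem Good.one_le_abs (hM : 2 ≤ M) {R : Run p m} {x : Fin 1 → ℝ} (h : R.Good M x) {j : ℕ}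
    (hj : j ≤ R.n) (z : ℤ) : 1 ≤ |R.slope M * ((M : ℝ) ^ j * R.time M x - z)| := by
  have hM1 : (1 : ℝ) ≤ M := by exact_mod_cast (by omega : 1 ≤ M)
  have h' := h ((M : ℤ) ^ (R.n - j) * z)
  have he : (M : ℝ) ^ R.n = (M : ℝ) ^ (R.n - j) * (M : ℝ) ^ j := by
    rw [← pow_add, Nat.sub_add_cancel hj]
  have h1 : (1 : ℝ) ≤ (M : ℝ) ^ j := one_le_pow₀ hM1
  have h2 : (0 : ℝ) < (M : ℝ) ^ (R.n - j) := by positivity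
  have : (M : ℝ) ^ R.n * R.time M x - (((M : ℤ) ^ (R.n - j) * z : ℤ) : ℝ) =
      (M : ℝ) ^ (R.n - j) * ((M : ℝ) ^ j * R.time M x - z) := by
    push_cast
    rw [he]
    ring
  rw [this, abs_mul, abs_of_pos h2] at h'
  rw [abs_mul, abs_of_pos (slope_pos hM R), slope, he]
  refine h'.trans ?_
  have h3 := abs_nonneg ((M : ℝ) ^ j * R.time M x - z)
  have h4 : (M : ℝ) ^ (R.n - j) * |(M : ℝ) ^ j * R.time M x - z| ≤
      (M : ℝ) ^ (R.n - j) * (M : ℝ) ^ j * |(M : ℝ) ^ j * R.time M x - z| :=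
    mul_le_mul_of_nonneg_right (le_mul_of_one_le_right h2.le h1) h3
  linarith

theorem init_eq (hM : 2 ≤ M) {R : Run p m} {x : Fin 1 → ℝ} (h : R.Good M x)
    (h₁ : -(N : ℤ) - 1 ≤ ⌊R.time M x⌋) (h₂ : ⌊R.time M x⌋ ≤ N) :
    R.init M N x (.inl 1) = Int.fract (R.time M x) := by
  have hr : ∀ k : ℤ, ramp (R.slope M * (R.time M x - k)) =
      if k ≤ ⌊R.time M x⌋ then 1 else 0 := fun k =>
    ramp_mul_sub (slope_pos hM R) (by simpa using h.one_le_abs hM (Nat.zero_le _) k)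
  change R.time M x + (N + 1) - ∑ k ∈ Finset.Icc (-(N : ℤ)) N,
    ramp (R.slope M * (R.time M x - k)) = _
  simp only [hr]
  rw [sum_Icc_ite_le h₁ h₂, Int.fract]
  push_cast
  ring

theorem digit_eq (hM : 2 ≤ M) {R : Run p m} {x : Fin 1 → ℝ} (h : R.Good M x) {j : ℕ}
    (hj : j + 1 ≤ R.n) {s : Reg p N → ℝ}
    (hs : s (.inl 1) = Int.fract ((M : ℝ) ^ j * R.time M x)) :
    R.digit M N s = dig M (R.time M x) j := by
  have hr : ∀ k : ℤ, ramp (R.slope M * (M * s (.inl 1) - k)) =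
      if k ≤ dig M (R.time M x) j then 1 else 0 := by
    intro k
    have h1 := h.one_le_abs hM hj (k + M * ⌊(M : ℝ) ^ j * R.time M x⌋)
    have h2 : M * s (.inl 1) - k = (M : ℝ) ^ (j + 1) * R.time M x -
        ((k + M * ⌊(M : ℝ) ^ j * R.time M x⌋ : ℤ) : ℝ) := by
      rw [hs, Int.fract]
      push_cast
      ring
    rw [h2, ramp_mul_sub (slope_pos hM R) h1, dig]
    simp only [le_sub_iff_add_le]
  rw [digit]
  simp only [hr]
  rw [sum_Icc_ite_le (by simpa using dig_nonneg hM _ _) (dig_le hM _ _)]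
  push_cast
  ring

/-- The first three registers contain the time `t`, the fractional part of `M ^ j t`, and the first
`j` digits of `t`. -/
def Holds (M : ℕ) (t : ℝ) (j : ℕ) (s : Reg p N → ℝ) : Prop :=
  s (.inl 0) = t ∧ s (.inl 1) = Int.fract ((M : ℝ) ^ j * t) ∧ s (.inl 2) = word M t j

theorem holds_forwardState (hM : 2 ≤ M) {R : Run p m} {x : Fin 1 → ℝ} (h : R.Good M x)
    (h₁ : -(N : ℤ) - 1 ≤ ⌊R.time M x⌋) (h₂ : ⌊R.time M x⌋ ≤ N) {j : ℕ} (hj : j ≤ R.n) :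
    Holds M (R.time M x) j (R.forwardState M N x j) := by
  induction j with
  | zero =>
    refine ⟨rfl, ?_, ?_⟩
    · rw [pow_zero, one_mul]
      exact init_eq hM h h₁ h₂
    · simp [word, forwardState, init]
  | succ j ih =>
    obtain ⟨i₀, i₁, i₂⟩ := ih (by omega)
    have hd := digit_eq hM h hj i₁
    refine ⟨i₀, ?_, ?_⟩
    · change M * R.forwardState M N x j (.inl 1) - R.digit M N (R.forwardState M N x j) = _
      rw [hd, i₁, mul_fract_eq]
      ring
    · change R.forwardState M N x j (.inl 2) +
        (M : ℝ) ^ j * R.digit M N (R.forwardState M N x j) = _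
      rw [hd, i₂, word_succ]
      push_cast
      ring

theorem thr_eq (hM : 2 ≤ M) {t : ℝ} {j : ℕ} {s : Reg p N → ℝ} (hs : Holds M t (j + 1) s)
    (k : ℤ) : thr M N j k s = if k ≤ dig M t j then 1 else 0 := by
  have := ramp_intCast_sub (word M t (j + 1)) (k * (M : ℤ) ^ j)
  simp only [mul_pow_le_word_iff hM] at this
  rw [← this, thr, hs.2.2]
  congr 1
  push_cast
  ring

theorem top_eq (hM : 2 ≤ M) {t : ℝ} {j : ℕ} {s : Reg p N → ℝ} (hs : Holds M t (j + 1) s) :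
    top M N j s = dig M t j := by
  rw [top]
  simp only [thr_eq hM hs]
  rw [sum_Icc_ite_le (by simpa using dig_nonneg hM _ _) (dig_le hM _ _)]
  push_cast
  ring

theorem inv_mul_eq_fract (hM : 2 ≤ M) {t : ℝ} {j : ℕ} {s : Reg p N → ℝ}
    (hs : Holds M t (j + 1) s) :
    (M : ℝ)⁻¹ * (s (.inl 1) + top M N j s) = Int.fract ((M : ℝ) ^ j * t) := by
  have hM' : (M : ℝ) ≠ 0 := by exact_mod_cast (by omega : M ≠ 0)
  rw [top_eq hM hs, hs.2.1, add_comm, ← mul_fract_eq, inv_mul_cancel_left₀ hM']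

theorem Holds.backward (hM : 2 ≤ M) {R : Run p m} {t : ℝ} {j : ℕ} {s : Reg p N → ℝ}
    (hs : Holds M t (j + 1) s) : Holds M t j (R.backward M N j s) := by
  refine ⟨hs.1, inv_mul_eq_fract hM hs, ?_⟩
  change s (.inl 2) - (M : ℝ) ^ j * top M N j s = _
  rw [top_eq hM hs, hs.2.2, word_succ]
  push_cast
  ring

/-- Only the summand of the actual digit survives the gates, and it is one step `ξ ↦ Vξ + E`. -/
theorem backward_inr (hM : 2 ≤ M) {R : Run p m} (hc₀ : 0 ≤ R.c) (hc₁ : R.c < 1) {t : ℝ} {j : ℕ}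
    (hj : j + 1 ≤ R.n) {s : Reg p N → ℝ} (hs : Holds M t (j + 1) s) {ξ : ℝ → Fin p → ℝ}
    (hξ : ∀ t, (N : ℝ) < |t| → ξ t = 0) (hK : ∀ t a, |ξ t a| ≤ R.K)
    (hv : ∀ i a, s (.inr (i, a)) = ξ (Int.fract ((M : ℝ) ^ (j + 1) * t) +
      R.c * (M : ℝ) ^ (j + 1) / (M : ℝ) ^ R.n + (i : ℤ)) a) (i : Window N) (a : Fin p) :
    R.backward M N j s (.inr (i, a)) = affineRefine M R.A R.E ξ
      (Int.fract ((M : ℝ) ^ j * t) + R.c * (M : ℝ) ^ j / (M : ℝ) ^ R.n + (i : ℤ)) a := by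
  have hM1 : (1 : ℝ) ≤ M := by exact_mod_cast (by omega : 1 ≤ M)
  have hn : (0 : ℝ) < (M : ℝ) ^ R.n := by positivity
  have hle : (M : ℝ) ^ (j + 1) ≤ (M : ℝ) ^ R.n := pow_le_pow_right₀ hM1 hj
  have hcn : R.c * (M : ℝ) ^ (j + 1) / (M : ℝ) ^ R.n < 1 := by
    rw [div_lt_one hn]
    have : (0 : ℝ) < (M : ℝ) ^ (j + 1) := by positivity
    nlinarith
  have hcn₀ : 0 ≤ R.c * (M : ℝ) ^ (j + 1) / (M : ℝ) ^ R.n := by positivity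
  have hf₀ := Int.fract_nonneg ((M : ℝ) ^ (j + 1) * t)
  have hf₁ := Int.fract_lt_one ((M : ℝ) ^ (j + 1) * t)
  rw [affineRefine_window (d := dig M t j) hξ
    (x := Int.fract ((M : ℝ) ^ (j + 1) * t) + R.c * (M : ℝ) ^ (j + 1) / (M : ℝ) ^ R.n)
    (by linarith) (by linarith) (by rw [mul_add, mul_fract_eq]; ring)]
  change R.E ((M : ℝ)⁻¹ * (s (.inl 1) + top M N j s) +
    (R.c * (M : ℝ) ^ j / (M : ℝ) ^ R.n + ((i : ℤ) : ℝ))) a +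
      ∑ k ∈ Finset.Icc (0 : ℤ) (M - 1), ∑ i' : Window N, ∑ a' : Fin p,
        R.A (k + M * i - i') a a' *
          clamp (s (.inr (i', a'))) (R.K * (thr M N j k s - thr M N j (k + 1) s)) = _
  rw [inv_mul_eq_fract hM hs, add_assoc]
  congr 1
  rw [Finset.sum_eq_single (dig M t j)]
  · refine Finset.sum_congr rfl fun i' _ => Finset.sum_congr rfl fun a' _ => ?_
    rw [thr_eq hM hs, thr_eq hM hs, ite_sub_ite_succ, hv, clamp_mul_ite (hK _ _), if_pos rfl]
  · intro k _ hk
    refine Finset.sum_eq_zero fun i' _ => Finset.sum_eq_zero fun a' _ => ?_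
    rw [thr_eq hM hs, thr_eq hM hs, ite_sub_ite_succ, hv, clamp_mul_ite (hK _ _),
      if_neg (Ne.symm hk), mul_zero]
  · intro h
    exact absurd (Finset.mem_Icc.2 ⟨dig_nonneg hM t j, dig_le hM t j⟩) h

/-- After `l` backward steps the values are those of the `l`-th iterate. The translation by
`c / M ^ n` of the time is undone at level `j` by adding `c M ^ j / M ^ n` to the fractional part of
`M ^ j t`. -/
theorem backwardState_spec (hM : 2 ≤ M) {R : Run p m} (hc₀ : 0 ≤ R.c) (hc₁ : R.c < 1)
    (hsupp : ∀ l t, (N : ℝ) < |t| → (affineRefine M R.A R.E)^[l] R.η t = 0)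
    (hK : ∀ l ≤ R.n, ∀ t a, |(affineRefine M R.A R.E)^[l] R.η t a| ≤ R.K)
    {x : Fin 1 → ℝ} (h : R.Good M x)
    (h₁ : -(N : ℤ) - 1 ≤ ⌊R.time M x⌋) (h₂ : ⌊R.time M x⌋ ≤ N) {l j : ℕ} (hlj : j + l = R.n) :
    Holds M (R.time M x) j (R.backwardState M N x l) ∧
    ∀ i a, R.backwardState M N x l (.inr (i, a)) = (affineRefine M R.A R.E)^[l] R.η
      (Int.fract ((M : ℝ) ^ j * R.time M x) + R.c * (M : ℝ) ^ j / (M : ℝ) ^ R.n + (i : ℤ)) a := by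
  induction l generalizing j with
  | zero =>
    obtain rfl : j = R.n := hlj
    have hs := holds_forwardState hM h h₁ h₂ le_rfl
    refine ⟨hs, fun i a => ?_⟩
    have hM' : (M : ℝ) ^ R.n ≠ 0 := by
      have : (M : ℝ) ≠ 0 := by exact_mod_cast (by omega : M ≠ 0)
      positivity
    change R.η (R.forwardState M N x R.n (.inl 1) + (R.c + ((i : ℤ) : ℝ))) a = _
    rw [hs.2.1, mul_div_cancel_right₀ _ hM', add_assoc]
    rfl
  | succ l ih =>
    obtain ⟨hs, hv⟩ := ih (j := j + 1) (by omega)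
    have hj : R.n - 1 - l = j := by omega
    rw [backwardState, hj, Function.iterate_succ_apply']
    exact ⟨hs.backward hM, backward_inr hM hc₀ hc₁ (by omega) hs (hsupp l) (hK l (by omega)) hv⟩

/-- Away from the finest grid, the machine computes the iterate exactly. -/
theorem output_eq (hM : 2 ≤ M) {R : Run p m} (hc₀ : 0 ≤ R.c) (hc₁ : R.c < 1)
    (hsupp : ∀ l t, (N : ℝ) < |t| → (affineRefine M R.A R.E)^[l] R.η t = 0)
    (hK : ∀ l ≤ R.n, ∀ t a, |(affineRefine M R.A R.E)^[l] R.η t a| ≤ R.K)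
    {x : Fin 1 → ℝ} (h : R.Good M x) :
    R.output M N x = (affineRefine M R.A R.E)^[R.n] R.η (x 0) := by
  have htime : ∀ l, R.backwardState M N x l (.inl 0) = R.time M x := by
    have hf : ∀ j, R.forwardState M N x j (.inl 0) = R.time M x := by
      intro j
      induction j with
      | zero => rfl
      | succ j ih => exact ih
    intro l
    induction l with
    | zero => exact hf R.n
    | succ l ih => exact ih
  have hr : ∀ k : ℤ, ramp (R.slope M * (R.time M x - k)) =
      if k ≤ ⌊R.time M x⌋ then 1 else 0 := fun k =>
    ramp_mul_sub (slope_pos hM R) (by simpa using h.one_le_abs hM (Nat.zero_le _) k)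
  have hgate : ∀ i : Window N,
      ramp (R.slope M * (R.backwardState M N x R.n (.inl 0) - ((i : ℤ) : ℝ))) -
        ramp (R.slope M * (R.backwardState M N x R.n (.inl 0) - ((i : ℤ) + 1 : ℝ))) =
      if ⌊R.time M x⌋ = i then 1 else 0 := by
    intro i
    have h1 := hr ((i : ℤ) + 1)
    push_cast at h1
    rw [htime, hr, h1, ite_sub_ite_succ]
  have hx : x 0 = R.time M x + R.c / (M : ℝ) ^ R.n := by
    rw [time]
    ring
  have hM1 : (1 : ℝ) ≤ M := by exact_mod_cast (by omega : 1 ≤ M)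
  have hn : (1 : ℝ) ≤ (M : ℝ) ^ R.n := one_le_pow₀ hM1
  funext a
  rw [output, select]
  simp only [hgate]
  by_cases hw : ⌊R.time M x⌋ ∈ Finset.Icc (-(N : ℤ) - 1) N
  · have hw' := Finset.mem_Icc.1 hw
    obtain ⟨-, hv⟩ := backwardState_spec hM hc₀ hc₁ hsupp hK h hw'.1 hw'.2 (zero_add R.n)
    rw [Finset.sum_eq_single ⟨_, hw⟩]
    · rw [hv, clamp_mul_ite (hK _ le_rfl _ _), if_pos rfl, pow_zero, one_mul, mul_one, Int.fract,
        hx]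
      exact congrFun (congrArg _ (by ring)) a
    · intro i _ hi
      rw [if_neg (fun h => hi (Subtype.ext h.symm)), mul_zero, clamp_zero]
    · intro h
      exact absurd (Finset.mem_univ _) h
  · rw [Finset.sum_eq_zero, hsupp, Pi.zero_apply]
    · rw [Finset.mem_Icc, not_and_or, not_le, not_le] at hw
      have h0 : 0 ≤ R.c / (M : ℝ) ^ R.n := by positivity
      have h1 : R.c / (M : ℝ) ^ R.n < 1 := by
        rw [div_lt_one (by linarith)]
        linarith
      rw [lt_abs]
      rcases hw with h | h
      · right
        have h2 : R.time M x < ((-(N : ℤ) - 1 : ℤ) : ℝ) := Int.floor_lt.1 h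
        push_cast at h2
        linarith
      · left
        have h2 : (((N : ℤ) + 1 : ℤ) : ℝ) ≤ R.time M x := Int.le_floor.1 h
        push_cast at h2
        linarith
    · intro i _
      rw [if_neg (fun h : ⌊R.time M x⌋ = i => hw (h ▸ i.2)), mul_zero, clamp_zero]

end Run

/-! ### The median of three runs -/

/-- The median of three numbers. -/
def median (a b c : ℝ) : ℝ := max (min a b) (min (max a b) c)

/-- If of any two of three numbers at least one equals `v`, then so does the median. -/
theorem median_eq {u : Fin 3 → ℝ} {v : ℝ} (h : ∀ i j, i ≠ j → u i = v ∨ u j = v) :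
    median (u 0) (u 1) (u 2) = v := by
  have h₀₁ := h 0 1 (by decide)
  have h₀₂ := h 0 2 (by decide)
  have h₁₂ := h 1 2 (by decide)
  rw [median]
  grind

/-- A point cannot be close to two of the translates of the grid `ℤ` by `0`, `1/3` and `2/3`. -/
theorem far_or_far (u : ℝ) {i j : Fin 3} (hij : i ≠ j) :
    (∀ z : ℤ, 1 ≤ 8 * |u - (i : ℕ) / 3 - z|) ∨ (∀ z : ℤ, 1 ≤ 8 * |u - (j : ℕ) / 3 - z|) := by
  by_contra! h
  obtain ⟨⟨z, hz⟩, ⟨z', hz'⟩⟩ := h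
  have h₁ := abs_lt.1 (show |u - (i : ℕ) / 3 - z| < 1 / 8 by linarith)
  have h₂ := abs_lt.1 (show |u - (j : ℕ) / 3 - z'| < 1 / 8 by linarith)
  have h₃ : ((((i : ℕ) : ℤ) - ((j : ℕ) : ℤ) + 3 * (z - z') : ℤ) : ℝ) < (1 : ℤ) := by
    push_cast
    linarith [h₁.1, h₂.2]
  have h₄ : ((-1 : ℤ) : ℝ) < ((((i : ℕ) : ℤ) - ((j : ℕ) : ℤ) + 3 * (z - z') : ℤ) : ℝ) := by
    push_cast
    linarith [h₁.2, h₂.1]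
  rw [Int.cast_lt] at h₃ h₄
  have := i.2
  have := j.2
  have : (i : ℕ) ≠ j := fun h => hij (Fin.ext h)
  omega

theorem Net.component {ι κ : Type} [Fintype ι] {W D : ℕ} {f : (ι → ℝ) → κ → ℝ} (h : Net W D f)
    (a : κ) : Net W D (fun x (_ : Unit) => f x a) := by
  obtain ⟨g, hg, K, b, rfl⟩ := h
  exact ⟨g, hg, fun _ j => K a j, fun _ => b a, rfl⟩

section Iterates

variable {p M : ℕ} {A : ℤ →₀ Matrix (Fin p) (Fin p) ℝ} {E ξ : ℝ → Fin p → ℝ}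

theorem continuous_refine (hξ : Continuous ξ) : Continuous (refine M A ξ) := by
  unfold refine
  fun_prop

theorem continuous_iterate_affineRefine (hE : Continuous E) (hξ : Continuous ξ) (l : ℕ) :
    Continuous ((affineRefine M A E)^[l] ξ) := by
  induction l with
  | zero => exact hξ
  | succ l ih =>
    rw [Function.iterate_succ_apply']
    exact (continuous_refine ih).add hE

theorem exists_bound_iterates {N : ℕ} (hE : Continuous E) (hξ : Continuous ξ)
    (hsupp : ∀ l t, (N : ℝ) < |t| → (affineRefine M A E)^[l] ξ t = 0) (n : ℕ) :
    ∃ K, ∀ l ≤ n, ∀ t a, |(affineRefine M A E)^[l] ξ t a| ≤ K := by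
  have hb : ∀ l, ∃ C, ∀ t, ‖(affineRefine M A E)^[l] ξ t‖ ≤ C := fun l =>
    (HasCompactSupport.intro (isCompact_Icc (a := -(N : ℝ)) (b := N)) fun t ht =>
      hsupp l t (by rwa [Set.mem_Icc, ← abs_le, not_le] at ht)).exists_bound_of_continuous
      (continuous_iterate_affineRefine hE hξ l)
  choose C hC using hb
  refine ⟨∑ l ∈ Finset.range (n + 1), C l, fun l hl t a => ?_⟩
  have h₁ := norm_le_pi_norm ((affineRefine M A E)^[l] ξ t) a
  rw [Real.norm_eq_abs] at h₁
  refine (h₁.trans (hC l t)).trans ?_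
  exact Finset.single_le_sum (f := C) (fun i _ => (norm_nonneg _).trans (hC i 0))
    (Finset.mem_range.2 (by omega))

end Iterates

/-- The iterates are realized by networks whose width and depth per step depend only on `M`, `p`,
the window and the number of hinges: three runs on grids translated against each other by thirds of
the finest step are combined by the median, since at any time at least two of them are exact. -/
theorem exists_net_add_iterate {M : ℕ} (hM : 2 ≤ M) (p N m : ℕ) :
    ∃ W D : ℕ, ∀ (A : ℤ →₀ Matrix (Fin p) (Fin p) ℝ) (E η Γ : ℝ → Fin p → ℝ),
      HingeSum m E → HingeSum m η → HingeSum m Γ →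
      (∀ l t, (N : ℝ) < |t| → (affineRefine M A E)^[l] η t = 0) →
      ∀ n : ℕ, Net W (D * (n + 1))
        (fun x : Fin 1 → ℝ => (Γ + (affineRefine M A E)^[n] η) (x 0)) := by
  obtain ⟨W₁, D₁, h₁⟩ := Run.exists_net_output M N p m
  let G : {Γ : ℝ → Fin p → ℝ // HingeSum m Γ} → ((Fin 3 × Fin p) ⊕ Unit → ℝ) → Fin p → ℝ :=
    fun θ s a => θ.1 (s (.inr ())) a +
      median (s (.inl (0, a))) (s (.inl (1, a))) (s (.inl (2, a)))
  have hG : ∀ a : Fin p, UnifNet (fun θ s => G θ s a) := by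
    intro a
    have hs : ∀ i : Fin 3, UnifNet (fun (_ : {Γ : ℝ → Fin p → ℝ // HingeSum m Γ})
        (s : (Fin 3 × Fin p) ⊕ Unit → ℝ) => s (.inl (i, a))) := fun i => UnifNet.coord _
    exact (HingeSum.unifNet (fun θ : {Γ : ℝ → Fin p → ℝ // HingeSum m Γ} => θ.2)
      (UnifNet.coord _) a).add
      (((hs 0).min (hs 1)).max (((hs 0).max (hs 1)).min (hs 2)))
  obtain ⟨W₂, D₂, h₂⟩ := UnifNet.exists_net_pi hG
  refine ⟨Fintype.card ((Fin 3 × Fin p) ⊕ Unit) * (W₁ + 2) + W₂, D₁ + D₂, ?_⟩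
  intro A E η Γ hE hη hΓ hsupp n
  obtain ⟨K, hK⟩ := exists_bound_iterates hE.continuous hη.continuous hsupp n
  let R : Fin 3 → Run p m := fun i => ⟨A, E, η, hE, hη, n, (i : ℕ) / 3, K⟩
  have hD : 1 ≤ D₁ * (n + 1) := (h₁ (R 0)).one_le
  let f : (Fin 1 → ℝ) → (Fin 3 × Fin p) ⊕ Unit → ℝ := fun x =>
    Sum.elim (fun i => (R i.1).output M N x i.2) fun _ => x 0
  have hf : Net (Fintype.card ((Fin 3 × Fin p) ⊕ Unit) * (W₁ + 2)) (D₁ * (n + 1)) f := by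
    refine Net.pi hD ?_
    rintro (⟨i, a⟩ | u)
    · exact ((h₁ (R i)).component a).mono_width (by omega)
    · exact (Net.coord 0).mono (by omega) hD
  have h := (h₂ _ (Nat.le_add_left _ _) ⟨Γ, hΓ⟩).comp (hf.mono_width (Nat.le_add_right _ W₂))
  have hval : (fun x : Fin 1 → ℝ => (Γ + (affineRefine M A E)^[n] η) (x 0)) =
      fun x => G ⟨Γ, hΓ⟩ (f x) := by
    funext x a
    change _ = Γ (x 0) a +
      median (f x (.inl (0, a))) (f x (.inl (1, a))) (f x (.inl (2, a)))
    rw [Pi.add_apply, Pi.add_apply]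
    congr 1
    refine (median_eq (u := fun i => f x (.inl (i, a))) fun i j hij => ?_).symm
    have hout : ∀ i : Fin 3, (∀ z : ℤ, 1 ≤ 8 * |(M : ℝ) ^ n * x 0 - (i : ℕ) / 3 - z|) →
        f x (.inl (i, a)) = (affineRefine M A E)^[n] η (x 0) a := by
      intro i hi
      have hi3 : ((i : ℕ) : ℝ) < 3 := by exact_mod_cast i.2
      refine congrFun (Run.output_eq hM (R := R i) (by positivity) ?_ hsupp hK fun z => ?_) a
      · change ((i : ℕ) : ℝ) / 3 < 1
        linarith
      · have hM' : (M : ℝ) ^ n ≠ 0 := pow_ne_zero _ (by exact_mod_cast (by omega : M ≠ 0))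
        have : (M : ℝ) ^ n * (R i).time M x = (M : ℝ) ^ n * x 0 - (i : ℕ) / 3 := by
          change (M : ℝ) ^ n * (x 0 - (i : ℕ) / 3 / (M : ℝ) ^ n) = _
          rw [mul_sub, mul_div_cancel₀ _ hM']
        change 1 ≤ 8 * |(M : ℝ) ^ n * (R i).time M x - z|
        rw [this]
        exact hi z
    exact (far_or_far ((M : ℝ) ^ n * x 0) hij).imp (hout i) (hout j)
  rw [hval]
  refine h.mono_depth ?_
  rw [add_mul]
  exact Nat.add_le_add_left (Nat.le_mul_of_pos_right _ (Nat.succ_pos n)) _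

/-! ### Anchored open curves -/

section Anchored

variable {p M : ℕ} {A : ℤ →₀ Matrix (Fin p) (Fin p) ℝ} {B Γ η : ℝ → Fin p → ℝ}

theorem refine_add (ξ ζ : ℝ → Fin p → ℝ) :
    refine M A (ξ + ζ) = refine M A ξ + refine M A ζ := by
  funext t
  simp [refine, Matrix.mulVec_add, Finset.sum_add_distrib]

/-- The anchor absorbs the affine part: conjugating `W` by the translation by `Γ` gives `V` plus the
mismatch of `Γ`. -/
theorem iterate_affineRefine_add (A : ℤ →₀ Matrix (Fin p) (Fin p) ℝ) (B Γ η : ℝ → Fin p → ℝ)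
    (n : ℕ) : (affineRefine M A B)^[n] (Γ + η) =
      Γ + (affineRefine M A (mismatch M A B Γ))^[n] η := by
  induction n with
  | zero => rfl
  | succ n ih =>
    rw [Function.iterate_succ_apply', Function.iterate_succ_apply', ih]
    generalize (affineRefine M A (mismatch M A B Γ))^[n] η = ξ
    simp only [affineRefine, mismatch, refine_add]
    abel

/-- Outside a window that contains the supports of `E` and `η` and all indices of the mask, the
iterates vanish, because `t ↦ M t - j` is expanding. -/
theorem iterate_affineRefine_eq_zero (hM : 2 ≤ M) {N : ℕ} {E : ℝ → Fin p → ℝ}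
    (hA : ∀ j ∈ A.support, |(j : ℝ)| ≤ N) (hE : ∀ t, (N : ℝ) < |t| → E t = 0)
    (hη : ∀ t, (N : ℝ) < |t| → η t = 0) (l : ℕ) (t : ℝ) (ht : (N : ℝ) < |t|) :
    (affineRefine M A E)^[l] η t = 0 := by
  induction l generalizing t with
  | zero => exact hη t ht
  | succ l ih =>
    rw [Function.iterate_succ_apply', affineRefine, Pi.add_apply, hE t ht, add_zero, refine]
    refine Finset.sum_eq_zero fun j hj => ?_
    rw [ih, Matrix.mulVec_zero]
    have hM' : (2 : ℝ) ≤ M := by exact_mod_cast hM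
    have h₁ := abs_sub_abs_le_abs_sub ((M : ℝ) * t) j
    rw [abs_mul, abs_of_nonneg (by linarith : (0 : ℝ) ≤ M)] at h₁
    have h₂ := hA j hj
    nlinarith [abs_nonneg t]

/-- The window hypothesis on `V` only concerns continuous curves, which the iterates are. -/
theorem tsupport_iterate_affineRefine_subset {L : ℕ} (hA : PreservesWindow M A L)
    {E : ℝ → Fin p → ℝ} (hEc : Continuous E) (hηc : Continuous η)
    (hE : tsupport E ⊆ Set.Icc 0 (L : ℝ)) (hη : tsupport η ⊆ Set.Icc 0 (L : ℝ)) (l : ℕ) :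
    tsupport ((affineRefine M A E)^[l] η) ⊆ Set.Icc 0 (L : ℝ) := by
  induction l with
  | zero => exact hη
  | succ l ih =>
    rw [Function.iterate_succ_apply']
    exact (tsupport_add _ _).trans (Set.union_subset
      (hA _ (continuous_iterate_affineRefine hEc hηc l) ih) hE)

theorem breakpoints_subset_tsupport (f : ℝ → Fin p → ℝ) : breakpoints f ⊆ tsupport f := by
  intro t ht
  by_contra h
  refine ht ⟨0, 0, ?_⟩
  filter_upwards [notMem_tsupport_iff_eventuallyEq.1 h] with s hs
  simp [hs]

theorem IsCPwL.finite_breakpoints_of_hasCompactSupport {f : ℝ → Fin p → ℝ} (hf : IsCPwL f)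
    (hs : HasCompactSupport f) : (breakpoints f).Finite := by
  obtain ⟨r, hr⟩ := hs.isCompact.isBounded.subset_closedBall 0
  rw [Real.closedBall_eq_Icc] at hr
  refine (hf.finite_breakpoints (0 - r) (0 + r)).subset fun t ht => ⟨ht, hr ?_⟩
  exact breakpoints_subset_tsupport f ht

theorem IsAnchorProfile.finite_breakpoints (h : IsAnchorProfile Γ) : (breakpoints Γ).Finite := by
  obtain ⟨hc, Γl, Γr, t₀, -, hl, hr⟩ := h
  refine (hc.finite_breakpoints (-t₀) t₀).subset fun t ht => ⟨ht, ?_⟩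
  by_contra hn
  rw [Set.mem_Icc, not_and_or, not_le, not_le] at hn
  rcases hn with hn | hn
  · refine ht ⟨Γl, 0, ?_⟩
    filter_upwards [Iio_mem_nhds hn] with s hs
    simp [hl s (Set.mem_Iio.1 hs).le]
  · refine ht ⟨Γr, 0, ?_⟩
    filter_upwards [Ioi_mem_nhds hn] with s hs
    simp [hr s (Set.mem_Ioi.1 hs).le]

theorem IsAnchorProfile.hingeSum {m : ℕ} (h : IsAnchorProfile Γ)
    (hm : (breakpoints Γ).encard ≤ m) : HingeSum m Γ := by
  obtain ⟨hc, Γl, -, t₀, -, hl, -⟩ := h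
  exact hingeSum_of_encard_breakpoints_le m hc.continuous hm hl

theorem IsCPwL.hingeSum {m : ℕ} {f : ℝ → Fin p → ℝ} (hf : IsCPwL f) (hs : HasCompactSupport f)
    (hm : (breakpoints f).encard ≤ m) : HingeSum m f := by
  obtain ⟨r, hr, h⟩ := hs.exists_pos_le_norm
  refine hingeSum_of_encard_breakpoints_le m hf.continuous hm (c := 0) (T := -r) fun t ht => h t ?_
  rw [Real.norm_eq_abs, le_abs]
  right
  linarith

end Anchored

end OpenCurve

end

open OpenCurve in
theorem mainTheorem4 (M p : ℕ) (hM : 2 ≤ M) :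
    -- the reduction and the quadratic-depth realization, for every anchored open curve
    (∀ (A : ℤ →₀ Matrix (Fin p) (Fin p) ℝ) (B Γ η : ℝ → Fin p → ℝ),
      IsAnchoredPair M A B Γ η →
        (∀ n : ℕ, 1 ≤ n →
          (affineRefine M A B)^[n] (Γ + η) =
            Γ + (affineRefine M A (mismatch M A B Γ))^[n] η) ∧
        ∃ C₀ C₁ : ℕ, 1 ≤ C₀ ∧ 1 ≤ C₁ ∧ ∀ n : ℕ, 1 ≤ n →
          IsRealizedBy ((affineRefine M A B)^[n] (Γ + η)) C₀ (C₁ * n ^ 2)) ∧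
    -- in a support window, the constants depend only on `M`, `p`, `L` and the breakpoint bound `m`
    (∀ L m : ℕ, 1 ≤ L →
      ∃ C₀ C₁ : ℕ, 1 ≤ C₀ ∧ 1 ≤ C₁ ∧
        ∀ (A : ℤ →₀ Matrix (Fin p) (Fin p) ℝ) (B Γ η : ℝ → Fin p → ℝ),
          PreservesWindow M A L →
          IsAnchoredPair M A B Γ η →
          tsupport η ⊆ Set.Icc 0 (L : ℝ) →
          tsupport (mismatch M A B Γ) ⊆ Set.Icc 0 (L : ℝ) →
          (breakpoints Γ).encard ≤ m →
          (breakpoints η).encard ≤ m →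
          (breakpoints (mismatch M A B Γ)).encard ≤ m →
          ∀ n : ℕ, 1 ≤ n →
            IsRealizedBy ((affineRefine M A B)^[n] (Γ + η)) C₀ (C₁ * n ^ 2)) := by
  -- the bound `D * (n + 1)` on the depth is linear in `n`, hence at most `(2 * D + 1) * n ^ 2`
  have hcore : ∀ N m : ℕ, ∃ C₀ C₁ : ℕ, 1 ≤ C₀ ∧ 1 ≤ C₁ ∧
      ∀ (A : ℤ →₀ Matrix (Fin p) (Fin p) ℝ) (B Γ η : ℝ → Fin p → ℝ),
        IsAnchoredPair M A B Γ η →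
        (breakpoints Γ).encard ≤ m →
        (breakpoints η).encard ≤ m →
        (breakpoints (mismatch M A B Γ)).encard ≤ m →
        (∀ l t, (N : ℝ) < |t| → (affineRefine M A (mismatch M A B Γ))^[l] η t = 0) →
        ∀ n : ℕ, 1 ≤ n →
          IsRealizedBy ((affineRefine M A B)^[n] (Γ + η)) C₀ (C₁ * n ^ 2) := by
    intro N m
    obtain ⟨W, D, h⟩ := exists_net_add_iterate hM p N m
    refine ⟨W + 1, 2 * D + 1, by omega, by omega, ?_⟩
    intro A B Γ η hpair hΓ hη hE hsupp n hn
    rw [iterate_affineRefine_add]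
    refine Net.isRealizedBy ((h A _ η Γ (hpair.mismatch_cpwl.hingeSum hpair.mismatch_supp hE)
      (hpair.defect_cpwl.hingeSum hpair.defect_supp hη) (hpair.anchor.hingeSum hΓ) hsupp n).mono
      (by omega) ?_)
    have h₁ : n + 1 ≤ 2 * n ^ 2 := by nlinarith
    calc D * (n + 1) ≤ D * (2 * n ^ 2) := Nat.mul_le_mul_left _ h₁
      _ ≤ (2 * D + 1) * n ^ 2 := by nlinarith
  refine ⟨fun A B Γ η hpair => ⟨fun n _ => iterate_affineRefine_add A B Γ η n, ?_⟩, ?_⟩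
  · obtain ⟨r₁, -, h₁⟩ := hpair.mismatch_supp.exists_pos_le_norm
    obtain ⟨r₂, -, h₂⟩ := hpair.defect_supp.exists_pos_le_norm
    obtain ⟨N, hN⟩ := exists_nat_ge (max (max r₁ r₂) (∑ j ∈ A.support, |(j : ℝ)|))
    have hN₁ : r₁ ≤ N := (le_max_left _ _).trans ((le_max_left _ _).trans hN)
    have hN₂ : r₂ ≤ N := (le_max_right _ _).trans ((le_max_left _ _).trans hN)
    have hNA : ∀ j ∈ A.support, |(j : ℝ)| ≤ N := fun j hj =>
      (Finset.single_le_sum (f := fun j : ℤ => |(j : ℝ)|) (fun _ _ => abs_nonneg _) hj).trans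
        ((le_max_right _ _).trans hN)
    have hcard : ∀ {s : Set ℝ} (m : ℕ), s.Finite → s.ncard ≤ m → s.encard ≤ m := by
      intro s m hs h
      rw [← hs.cast_ncard_eq]
      exact_mod_cast h
    obtain ⟨C₀, C₁, hC₀, hC₁, h⟩ := hcore N ((breakpoints Γ).ncard + (breakpoints η).ncard +
      (breakpoints (mismatch M A B Γ)).ncard)
    refine ⟨C₀, C₁, hC₀, hC₁, h A B Γ η hpair
      (hcard _ hpair.anchor.finite_breakpoints (by omega))
      (hcard _ (hpair.defect_cpwl.finite_breakpoints_of_hasCompactSupport hpair.defect_supp)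
        (by omega))
      (hcard _ (hpair.mismatch_cpwl.finite_breakpoints_of_hasCompactSupport hpair.mismatch_supp)
        (by omega))
      (iterate_affineRefine_eq_zero hM hNA (fun t ht => h₁ t ?_) fun t ht => h₂ t ?_)⟩
    · exact hN₁.trans ht.le
    · exact hN₂.trans ht.le
  · intro L m _
    obtain ⟨C₀, C₁, hC₀, hC₁, h⟩ := hcore L m
    refine ⟨C₀, C₁, hC₀, hC₁, ?_⟩
    intro A B Γ η hA hpair hηL hEL hΓm hηm hEm
    refine h A B Γ η hpair hΓm hηm hEm fun l t ht => ?_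
    refine image_eq_zero_of_notMem_tsupport fun hmem => ?_
    have h₁ := tsupport_iterate_affineRefine_subset hA hpair.mismatch_cpwl.continuous
      hpair.defect_cpwl.continuous hEL hηL l hmem
    rw [abs_of_nonneg h₁.1] at ht
    exact absurd h₁.2 (not_le.2 ht)
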